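/- **Conventions.** A meet-semilattice is a poset with all finite meets (so it has a top $1$, but possibly no bottom). It is distributive if $a\wedge b\le c$ implies $c=a'\wedge b'$ for some $a'\ge a$, $b'\ge b$. $\mathsf{DMS}$ is the category of distributive meet-semilattices and maps preserving finite meets (including $1$). $\mathsf{AlgFrm_J}$ is the category of algebraic frames (frames in which every element is a join of compact elements) and maps preserving arbitrary joins and compact elements. Let $X$ be a Priestley space and $X_0\subseteq X$. A clopen upset $U$ of $X$ is admissible if every maximal point of $X\setminus U$ lies in $X_0$; $\mathcal A(X)$ is the set of these, and $\mathcal I_x=\{U\in\mathcal A(X): x\notin U\}$. A pointed generalized Priestley space is a tuple $\langle X,\tau,\le,X_0,m\rangle$ such that $\langle X,\tau,\le\rangle$ is a (compact) Priestley space, $m$ is its maximum, $X_0$ is a dense subset of $X\setminus\{m\}$, every $x\ne m$ lies below some point of $X_0$, $x\in X_0$ iff $\mathcal I_x$ is nonempty and directed, and $x\le y$ iff every $U\in\mathcal A(X)$ that contains $x$ contains $y$. For $R\subseteq X\times Y$ let $\Box_RU=\{x: R[x]\subseteq U\}$. A morphism from $X$ to $Y$ in $\mathsf{PGPS}$ is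 a relation $R\subseteq X\times Y$ such that (1) if not $x\,R\,y$, then there is $U\in\mathcal A(Y)$ with $R[x]\subseteq U$ and $y\notin U$, and (2) $\Box_RU\in\mathcal A(X)$ for all $U\in\mathcal A(Y)$. Identities are the orders, and $x\,(S*R)\,z$ iff every $U\in\mathcal A(Z)$ with $x\in\Box_R\Box_SU$ contains $z$. **Functors.** * $\mathcal F:\mathsf{DMS}\to\mathsf{AlgFrm_J}$ sends $M$ to its lattice of filters under inclusion and $\alpha$ to $F\mapsto{\uparrow}\alpha[F]$. * $\mathcal K:\mathsf{AlgFrm_J}\to\mathsf{DMS}$ sends $L$ to its set of compact elements under the order dual to that of $L$ and a morphism to its restriction. * $\mathcal V^a:\mathsf{PGPS}\to\mathsf{AlgFrm_J}$ (contravariant) sends $X$ to the set of closed upsets $C$ with $X\setminus C={\downarrow}(X_0\setminus C)$ under reverse inclusion, and $R$ to $\Box_R$. * $\mathcal Y:\mathsf{AlgFrm_J}\to\mathsf{PGPS}$ (contravariant) sends $L$ to $\langle Y_L,\tau,\le,P(L),1\rangle$. Here $P(L)$ is the set of (meet-)prime elements; $Y_L$ consists of $1$ and of the pseudoprime elements of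 $L$, i.e. those $p\neq1$ such that $a_1\wedge\dots\wedge a_n\ll p$ implies $a_i\le p$ for some $i$; and $\tau$ is the restriction to $Y_L$ of the topology on $L$ with subbasis the sets ${\uparrow}k$ and their complements, $k$ compact. It sends $\alpha:L\to N$ with right adjoint $r$ to the relation $\{(p,q)\in Y_N\times Y_L: r(p)\le q\}$. * $\mathcal A:\mathsf{PGPS}\to\mathsf{DMS}$ (contravariant) sends $X$ to $\mathcal A(X)$ under inclusion and $R$ to $\Box_R$. * $\mathcal X:\mathsf{DMS}\to\mathsf{PGPS}$ (contravariant) sends $M$ to $\langle X_M,\tau,\subseteq,\mathrm{Pr}(M),M\rangle$. Here $X_M$ consists of the improper filter $M$ and of the optimal filters of $M$, i.e. the restrictions to $M$ of the prime filters of the distributive envelope $D(M)$, the universal distributive lattice with top under $M$ with respect to maps preserving finite meets and all existing finite joins; $\mathrm{Pr}(M)$ is the set of proper filters $P$ such that $F\cap G\subseteq P$ implies $F\subseteq P$ or $G\subseteq P$ for all filters $F,G$; and $\tau$ has as subbasis the sets $\{x\in X_M: a\in x\}$, $a\in M$, and their complements. It sends $\alpha:M\to N$ to the relation $\{(x,y)\in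 X_N\times X_M:\alpha^{-1}(x)\subseteq y\}$. **Theorem.** All six are well-defined functors. $\mathcal F$ and $\mathcal K$ establish an equivalence of $\mathsf{DMS}$ and $\mathsf{AlgFrm_J}$, $\mathcal Y$ and $\mathcal V^a$ establish a dual equivalence of $\mathsf{AlgFrm_J}$ and $\mathsf{PGPS}$, and $\mathcal X$ and $\mathcal A$ establish a dual equivalence of $\mathsf{DMS}$ and $\mathsf{PGPS}$. Moreover, the last pair consists of compositions of the other functors: $$\mathcal X=\mathcal Y\circ\mathcal F\qquad\text{and}\qquad\mathcal A=\mathcal K\circ\mathcal V^a .$$ (In the second equality, admissible clopen upsets are identified with the compact elements of $\mathcal V^a(X)$ via $U\mapsto U$, naturally in $X$.) -/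

import Mathlib

open CategoryTheory Order

universe u

namespace GenPriestley

set_option linter.unusedSectionVars false
set_option linter.style.haveILetI false

/-! ### Distributive meet-semilattices (with top) -/

/-- Distributivity of a meet-semilattice. -/
def IsDistribMeet (M : Type u) [SemilatticeInf M] : Prop :=
  ∀ a b c : M, a ⊓ b ≤ c → ∃ a' b' : M, a ≤ a' ∧ b ≤ b' ∧ a' ⊓ b' = c

/-- Distributive meet-semilattices with top (a bottom is not required). -/
structure DMS : Type (u + 1) where
  carrier : Type u
  [semilatticeInf : SemilatticeInf carrier]
  [orderTop : OrderTop carrier]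
  distrib : IsDistribMeet carrier

instance : CoeSort DMS.{u} (Type u) := ⟨DMS.carrier⟩

attribute [instance] DMS.semilatticeInf DMS.orderTop

/-- Morphisms of `DMS` are the maps preserving all finite meets, the empty one included. -/
instance : Category.{u} DMS.{u} where
  Hom M N := InfTopHom M N
  id M := InfTopHom.id M
  comp f g := g.comp f

/-! ### Algebraic frames -/

/-- The join infinite distributive law. -/
def IsFrameLattice (L : Type u) [CompleteLattice L] : Prop :=
  ∀ (a : L) (S : Set L), a ⊓ sSup S = ⨆ s ∈ S, a ⊓ s

/-- Algebraic frames: frames in which every element is a join of compact elements. -/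
structure AlgFrmJ : Type (u + 1) where
  carrier : Type u
  [completeLattice : CompleteLattice carrier]
  [algebraic : IsCompactlyGenerated carrier]
  frame : IsFrameLattice carrier

instance : CoeSort AlgFrmJ.{u} (Type u) := ⟨AlgFrmJ.carrier⟩

attribute [instance] AlgFrmJ.completeLattice AlgFrmJ.algebraic

/-- Maps preserving arbitrary joins and compact elements. -/
@[ext]
structure AlgFrmJ.Hom (L N : AlgFrmJ.{u}) : Type u where
  toFun : L → N
  map_sSup : ∀ S : Set L, toFun (sSup S) = sSup (toFun '' S)
  map_compact : ∀ k : L, IsCompactElement k → IsCompactElement (toFun k)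

instance : Category.{u} AlgFrmJ.{u} where
  Hom L N := AlgFrmJ.Hom L N
  id L := ⟨id, fun S => by simp, fun _ h => h⟩
  comp f g := ⟨g.toFun ∘ f.toFun,
    fun S => by simp [f.map_sSup, g.map_sSup, Set.image_image],
    fun k h => g.map_compact _ (f.map_compact k h)⟩

/-! ### Pointed generalized Priestley spaces -/

section Spaces

variable {X Y Z : Type u} [TopologicalSpace X] [PartialOrder X] [TopologicalSpace Y]
  [PartialOrder Y] [TopologicalSpace Z] [PartialOrder Z]

/-- Admissible clopen upsets, relative to the distinguished subset `X₀`: all maximal points of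
the complement lie in `X₀`. -/
structure IsAdmissible (X₀ : Set X) (U : Set X) : Prop where
  isClopen : IsClopen U
  isUpperSet : IsUpperSet U
  maximal_mem : ∀ x, Maximal (· ∈ Uᶜ) x → x ∈ X₀

/-- `𝓘ₓ`: the admissible clopen upsets that miss `x`. -/
def missing (X₀ : Set X) (x : X) : Set (Set X) := {U | IsAdmissible X₀ U ∧ x ∉ U}

/-- Pointed generalized Priestley spaces. -/
structure IsPGPS (X₀ : Set X) (m : X) : Prop where
  compact : CompactSpace X
  priestley : PriestleySpace X
  isTop : IsTop m
  subset : X₀ ⊆ {m}ᶜ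
  dense : {m}ᶜ ⊆ closure X₀
  order_dense : ∀ x ∈ ({m}ᶜ : Set X), ∃ y ∈ X₀, x ≤ y
  mem_iff : ∀ x, x ∈ X₀ ↔ (missing X₀ x).Nonempty ∧ DirectedOn (· ⊆ ·) (missing X₀ x)
  le_iff : ∀ x y, x ≤ y ↔ ∀ U, IsAdmissible X₀ U → x ∈ U → y ∈ U

/-- `□_R U = {x | R[x] ⊆ U}`. -/
def box (R : X → Y → Prop) (U : Set Y) : Set X := {x | ∀ y, R x y → y ∈ U}

/-- Generalized Priestley morphisms. -/
structure IsGPMorphism (X₀ : Set X) (Y₀ : Set Y) (R : X → Y → Prop) : Prop where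
  separated : ∀ x y, ¬ R x y → ∃ U, IsAdmissible Y₀ U ∧ (∀ z, R x z → z ∈ U) ∧ y ∉ U
  box_admissible : ∀ U, IsAdmissible Y₀ U → IsAdmissible X₀ (box R U)

/-- The composition `S * R` of `R ⊆ X × Y` and `S ⊆ Y × Z`. -/
def starComp (Z₀ : Set Z) (R : X → Y → Prop) (S : Y → Z → Prop) : X → Z → Prop :=
  fun x z => ∀ U, IsAdmissible Z₀ U → x ∈ box R (box S U) → z ∈ U

theorem starComp_of {Z₀ : Set Z} {R : X → Y → Prop} {S : Y → Z → Prop} {x : X} {y : Y} {z : Z}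
    (h : R x y) (h' : S y z) : starComp Z₀ R S x z := fun _ _ hx => hx y h z h'

theorem box_starComp {Z₀ : Set Z} (R : X → Y → Prop) (S : Y → Z → Prop) {U : Set Z}
    (hU : IsAdmissible Z₀ U) : box (starComp Z₀ R S) U = box R (box S U) := by
  ext x
  exact ⟨fun hx y hy z hz => hx z (starComp_of hy hz), fun hx z hz => hz U hU hx⟩

theorem box_le {U : Set X} (hU : IsUpperSet U) : box (fun x y : X => x ≤ y) U = U := by
  ext x
  exact ⟨fun hx => hx x le_rfl, fun hx y hy => hU hy hx⟩

theorem IsPGPS.isGPMorphism_le {X₀ : Set X} {m : X} (h : IsPGPS X₀ m) :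
    IsGPMorphism X₀ X₀ (fun x y : X => x ≤ y) where
  separated x y hxy := by
    rw [h.le_iff] at hxy
    push Not at hxy
    obtain ⟨U, hU, hx, hy⟩ := hxy
    exact ⟨U, hU, fun z hz => hU.isUpperSet hz hx, hy⟩
  box_admissible U hU := by rwa [box_le hU.isUpperSet]

theorem IsGPMorphism.starComp {X₀ : Set X} {Y₀ : Set Y} {Z₀ : Set Z} {R : X → Y → Prop}
    {S : Y → Z → Prop} (hR : IsGPMorphism X₀ Y₀ R) (hS : IsGPMorphism Y₀ Z₀ S) :
    IsGPMorphism X₀ Z₀ (starComp Z₀ R S) where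
  separated x z hxz := by
    unfold GenPriestley.starComp at hxz
    push Not at hxz
    obtain ⟨U, hU, hx, hz⟩ := hxz
    exact ⟨U, hU, fun w hw => hw U hU hx, hz⟩
  box_admissible U hU := by
    rw [box_starComp R S hU]
    exact hR.box_admissible _ (hS.box_admissible _ hU)

theorem IsGPMorphism.iff_forall {X₀ : Set X} {Y₀ : Set Y} {R : X → Y → Prop}
    (hR : IsGPMorphism X₀ Y₀ R) (x : X) (y : Y) :
    R x y ↔ ∀ U, IsAdmissible Y₀ U → x ∈ box R U → y ∈ U := by
  refine ⟨fun h U _ hx => hx y h, fun h => ?_⟩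
  by_contra hxy
  obtain ⟨U, hU, hx, hy⟩ := hR.separated x y hxy
  exact hy (h U hU hx)

end Spaces

/-- Bundled pointed generalized Priestley spaces. -/
structure PGPS : Type (u + 1) where
  carrier : Type u
  [topology : TopologicalSpace carrier]
  [order : PartialOrder carrier]
  dom : Set carrier
  pt : carrier
  isPGPS : IsPGPS dom pt

instance : CoeSort PGPS.{u} (Type u) := ⟨PGPS.carrier⟩

attribute [instance] PGPS.topology PGPS.order

/-- Generalized Priestley morphisms between bundled spaces. -/
@[ext]
structure PGPS.Hom (X Y : PGPS.{u}) : Type u where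
  rel : X → Y → Prop
  isGPMorphism : IsGPMorphism X.dom Y.dom rel

/-- The identity of `X` is its order, and composition is `*`. -/
instance : Category.{u} PGPS.{u} where
  Hom X Y := PGPS.Hom X Y
  id X := ⟨fun x y => x ≤ y, X.isPGPS.isGPMorphism_le⟩
  comp {_ _ Z} R S := ⟨starComp Z.dom R.rel S.rel, R.isGPMorphism.starComp S.isGPMorphism⟩
  id_comp {X Y} R := by
    apply PGPS.Hom.ext
    funext x y
    apply propext
    rw [R.isGPMorphism.iff_forall]
    refine forall₂_congr fun U hU => ?_
    rw [box_le (R.isGPMorphism.box_admissible U hU).isUpperSet]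
  comp_id {X Y} R := by
    apply PGPS.Hom.ext
    funext x y
    apply propext
    rw [R.isGPMorphism.iff_forall]
    refine forall₂_congr fun U hU => ?_
    rw [box_le hU.isUpperSet]
  assoc {W X Y Z} R S T := by
    apply PGPS.Hom.ext
    funext x y
    apply propext
    refine forall₂_congr fun U hU => ?_
    rw [box_starComp _ _ (T.isGPMorphism.box_admissible U hU), box_starComp _ _ hU]

/-! ### The filter functor -/

section Filters

variable {M N : Type u} [SemilatticeInf M] [OrderTop M] [SemilatticeInf N] [OrderTop N]

/-- A filter from an upset that contains `⊤` and is closed under binary meets. -/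
def mkFilter (S : Set M) (top : ⊤ ∈ S) (inf : ∀ a ∈ S, ∀ b ∈ S, a ⊓ b ∈ S)
    (up : ∀ a b, a ≤ b → a ∈ S → b ∈ S) : PFilter M :=
  (IsPFilter.of_def (F := S) ⟨⊤, top⟩
    (fun a ha b hb => ⟨a ⊓ b, inf a ha b hb, inf_le_left, inf_le_right⟩)
    (fun {a b} h ha => up a b h ha)).toPFilter

theorem mem_mkFilter {S : Set M} {top inf up} {a : M} :
    a ∈ mkFilter S top inf up ↔ a ∈ S := Iff.rfl

theorem top_mem_filter (F : PFilter M) : ⊤ ∈ F := by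
  obtain ⟨a, ha⟩ := F.nonempty
  exact PFilter.mem_of_le le_top ha

/-- The intersection of a family of filters. -/
instance : InfSet (PFilter M) where
  sInf S := mkFilter {a | ∀ F ∈ S, a ∈ F} (fun F _ => top_mem_filter F)
    (fun _ ha _ hb F hF => PFilter.inf_mem (ha F hF) (hb F hF))
    (fun _ _ h ha F hF => PFilter.mem_of_le h (ha F hF))

/-- The lattice of filters, ordered by inclusion. -/
instance : CompleteLattice (PFilter M) :=
  completeLatticeOfInf (PFilter M) fun S =>
    ⟨fun F hF _ ha => ha F hF, fun _ hG _ ha F hF => hG hF ha⟩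

theorem mem_sInf_filter {S : Set (PFilter M)} {a : M} : a ∈ sInf S ↔ ∀ F ∈ S, a ∈ F := Iff.rfl

theorem mem_inf_filter {F G : PFilter M} {a : M} : a ∈ F ⊓ G ↔ a ∈ F ∧ a ∈ G := by
  constructor
  · intro h
    exact ⟨(inf_le_left : F ⊓ G ≤ F) h, (inf_le_right : F ⊓ G ≤ G) h⟩
  · rintro ⟨hF, hG⟩
    have : PFilter.principal a ≤ F ⊓ G :=
      le_inf (PFilter.principal_le_iff.2 hF) (PFilter.principal_le_iff.2 hG)
    exact PFilter.principal_le_iff.1 this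

theorem mem_top_filter (a : M) : a ∈ (⊤ : PFilter M) :=
  PFilter.principal_le_iff.1 le_top

theorem mem_sSup_filter_of_directed {S : Set (PFilter M)} (hne : S.Nonempty)
    (hS : DirectedOn (· ≤ ·) S) {a : M} : a ∈ sSup S ↔ ∃ F ∈ S, a ∈ F := by
  refine ⟨fun h => ?_, fun ⟨F, hF, ha⟩ => (le_sSup hF : F ≤ sSup S) ha⟩
  let G : PFilter M := mkFilter {a | ∃ F ∈ S, a ∈ F}
    (let ⟨F, hF⟩ := hne; ⟨F, hF, top_mem_filter F⟩)
    (by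
      rintro a ⟨F, hF, ha⟩ b ⟨G, hG, hb⟩
      obtain ⟨H, hH, h1, h2⟩ := hS F hF G hG
      exact ⟨H, hH, PFilter.inf_mem (h1 ha) (h2 hb)⟩)
    (fun a b h ⟨F, hF, ha⟩ => ⟨F, hF, PFilter.mem_of_le h ha⟩)
  have : sSup S ≤ G := sSup_le fun F hF b hb => ⟨F, hF, hb⟩
  exact this h

theorem isCompactElement_principal (a : M) : IsCompactElement (PFilter.principal a) := by
  rw [CompleteLattice.isCompactElement_iff_le_of_directed_sSup_le]
  intro S hne hS h
  rw [PFilter.principal_le_iff, mem_sSup_filter_of_directed hne hS] at h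
  obtain ⟨F, hF, ha⟩ := h
  exact ⟨F, hF, PFilter.principal_le_iff.2 ha⟩

theorem sSup_principal (F : PFilter M) : sSup (PFilter.principal '' (F : Set M)) = F := by
  refine le_antisymm (sSup_le ?_) fun a ha => ?_
  · rintro _ ⟨a, ha, rfl⟩
    exact PFilter.principal_le_iff.2 ha
  · exact PFilter.principal_le_iff.1 (le_sSup ⟨a, ha, rfl⟩)

theorem isCompactElement_filter_iff {F : PFilter M} :
    IsCompactElement F ↔ ∃ a, F = PFilter.principal a := by
  refine ⟨fun h => ?_, ?_⟩
  · rw [CompleteLattice.isCompactElement_iff_le_of_directed_sSup_le] at h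
    have hdir : DirectedOn (· ≤ ·) (PFilter.principal '' (F : Set M)) := by
      rintro _ ⟨a, ha, rfl⟩ _ ⟨b, hb, rfl⟩
      exact ⟨_, ⟨a ⊓ b, PFilter.inf_mem ha hb, rfl⟩, PFilter.antitone_principal inf_le_left,
        PFilter.antitone_principal inf_le_right⟩
    obtain ⟨G, ⟨a, ha, rfl⟩, hF⟩ := h (PFilter.principal '' (F : Set M))
      (F.nonempty.image _) hdir (sSup_principal F).ge
    exact ⟨a, le_antisymm hF (PFilter.principal_le_iff.2 ha)⟩
  · rintro ⟨a, rfl⟩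
    exact isCompactElement_principal a

instance : IsCompactlyGenerated (PFilter M) where
  exists_sSup_eq F := ⟨PFilter.principal '' (F : Set M), by
    rintro _ ⟨a, -, rfl⟩
    exact isCompactElement_principal a, sSup_principal F⟩

theorem isFrameLattice_filter (hM : IsDistribMeet M) : IsFrameLattice (PFilter M) := by
  intro F S
  refine le_antisymm ?_ (iSup₂_le fun G hG => inf_le_inf_left _ (le_sSup hG))
  set T : PFilter M := ⨆ G ∈ S, F ⊓ G with hT
  let H : PFilter M := mkFilter {x | ∀ a ∈ F, x ≤ a → a ∈ T}
    (fun a _ h => by rw [top_le_iff.1 h]; exact top_mem_filter T)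
    (by
      intro x hx y hy a ha hxy
      obtain ⟨x', y', h1, h2, rfl⟩ := hM x y a hxy
      exact PFilter.inf_mem (hx x' (PFilter.mem_of_le inf_le_left ha) h1)
        (hy y' (PFilter.mem_of_le inf_le_right ha) h2))
    (fun x y h hx a ha hy => hx a ha (h.trans hy))
  have hSH : sSup S ≤ H := sSup_le fun G hG x hx a ha hxa =>
    (le_iSup₂_of_le (f := fun G (_ : G ∈ S) => F ⊓ G) G hG le_rfl : F ⊓ G ≤ T)
      (mem_inf_filter.2 ⟨ha, PFilter.mem_of_le hxa hx⟩)
  intro a ha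
  rw [mem_inf_filter] at ha
  exact hSH ha.2 a ha.1 le_rfl

/-- The preimage of a filter. -/
def filterComap (f : InfTopHom M N) (G : PFilter N) : PFilter M :=
  mkFilter {a | f a ∈ G} (by simp [top_mem_filter G])
    (fun a ha b hb => by simpa using PFilter.inf_mem ha hb)
    (fun a b h ha => PFilter.mem_of_le (OrderHomClass.mono f h) ha)

/-- `↑f[F]`, the upset generated by the image of a filter. -/
def filterMap (f : InfTopHom M N) (F : PFilter M) : PFilter N :=
  mkFilter {b | ∃ a ∈ F, f a ≤ b} ⟨⊤, top_mem_filter F, le_top⟩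
    (by
      rintro b ⟨a, ha, hab⟩ d ⟨c, hc, hcd⟩
      exact ⟨a ⊓ c, PFilter.inf_mem ha hc, by rw [map_inf]; exact inf_le_inf hab hcd⟩)
    (fun b c h ⟨a, ha, hab⟩ => ⟨a, ha, hab.trans h⟩)

theorem filter_gc (f : InfTopHom M N) : GaloisConnection (filterMap f) (filterComap f) := by
  intro F G
  refine ⟨fun h a ha => h ⟨a, ha, le_rfl⟩, ?_⟩
  rintro h b ⟨a, ha, hab⟩
  exact PFilter.mem_of_le hab (h ha)

theorem filterMap_principal (f : InfTopHom M N) (a : M) :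
    filterMap f (PFilter.principal a) = PFilter.principal (f a) := by
  refine le_antisymm ?_ (PFilter.principal_le_iff.2 ⟨a, PFilter.principal_le_iff.1 le_rfl, le_rfl⟩)
  rw [filter_gc f _ _, PFilter.principal_le_iff]
  show f a ∈ PFilter.principal (f a)
  exact PFilter.principal_le_iff.1 le_rfl

end Filters

/-- The functor `𝓕`: it sends `M` to its lattice of filters and `α` to `F ↦ ↑α[F]`. -/
def filterFunctor : DMS.{u} ⥤ AlgFrmJ.{u} where
  obj M := { carrier := PFilter M, frame := isFrameLattice_filter M.distrib }
  map {M N} α :=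
    { toFun := filterMap (M := M) (N := N) α
      map_sSup := fun S => by
        rw [sSup_image]
        exact (filter_gc (M := M) (N := N) α).l_sSup
      map_compact := fun F hF => by
        obtain ⟨a, rfl⟩ := isCompactElement_filter_iff.1 hF
        rw [filterMap_principal]
        exact isCompactElement_principal _ }
  map_id M := by
    apply AlgFrmJ.Hom.ext
    funext F
    apply le_antisymm
    · rintro b ⟨a, ha, hab⟩
      exact PFilter.mem_of_le hab ha
    · exact fun a ha => ⟨a, ha, le_rfl⟩
  map_comp {M N P} α β := by
    apply AlgFrmJ.Hom.ext
    funext F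
    apply le_antisymm
    · rintro b ⟨a, ha, hab⟩
      exact ⟨_, ⟨a, ha, le_rfl⟩, hab⟩
    · rintro b ⟨a, ⟨c, hc, hca⟩, hab⟩
      exact ⟨c, hc, le_trans (OrderHomClass.mono (show InfTopHom N P from β) hca) hab⟩

/-! ### The functor of compact elements -/

section Compact

variable {L : Type u} [CompleteLattice L]

theorem isCompactElement_bot : IsCompactElement (⊥ : L) := by
  rw [CompleteLattice.isCompactElement_iff_le_of_directed_sSup_le]
  exact fun S ⟨a, ha⟩ _ _ => ⟨a, ha, bot_le⟩

theorem compact_sup {a b : L} (ha : IsCompactElement a) (hb : IsCompactElement b) :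
    IsCompactElement (a ⊔ b) := by
  rw [CompleteLattice.isCompactElement_iff_le_of_directed_sSup_le] at *
  intro S hne hS h
  obtain ⟨x, hx, hax⟩ := ha S hne hS (le_sup_left.trans h)
  obtain ⟨y, hy, hby⟩ := hb S hne hS (le_sup_right.trans h)
  obtain ⟨z, hz, hxz, hyz⟩ := hS x hx y hy
  exact ⟨z, hz, sup_le (hax.trans hxz) (hby.trans hyz)⟩

/-- The compact elements below a given one form a directed set. -/
theorem directedOn_compact_le (b : L) :
    DirectedOn (· ≤ ·) {k : L | IsCompactElement k ∧ k ≤ b} := fun x hx y hy =>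
  ⟨x ⊔ y, ⟨compact_sup hx.1 hy.1, sup_le hx.2 hy.2⟩, le_sup_left, le_sup_right⟩

theorem exists_compact_not_le [IsCompactlyGenerated L] {a b : L} (h : ¬ a ≤ b) :
    ∃ k, IsCompactElement k ∧ k ≤ a ∧ ¬ k ≤ b := by
  rw [le_iff_compact_le_imp] at h
  push Not at h
  exact h

theorem IsFrameLattice.inf_sup (hL : IsFrameLattice L) (a b c : L) :
    a ⊓ (b ⊔ c) = (a ⊓ b) ⊔ (a ⊓ c) := by
  have := hL a {b, c}
  rwa [sSup_pair, iSup_pair] at this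

theorem IsFrameLattice.sup_inf_le (hL : IsFrameLattice L) (a b c : L) :
    (a ⊔ b) ⊓ (a ⊔ c) ≤ a ⊔ (b ⊓ c) := by
  rw [hL.inf_sup]
  refine sup_le (inf_le_right.trans le_sup_left) ?_
  rw [inf_comm, hL.inf_sup]
  exact sup_le (inf_le_right.trans le_sup_left) (by rw [inf_comm]; exact le_sup_right)

/-- The compact elements of `L`. -/
@[ext]
structure CompactElt (L : Type u) [CompleteLattice L] : Type u where
  val : L
  isCompact : IsCompactElement val

/-- Compact elements carry the order *dual* to that of `L`, so that meets are joins of `L` and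
the top is the bottom of `L`. -/
instance : SemilatticeInf (CompactElt L) where
  le k l := l.val ≤ k.val
  le_refl _ := le_rfl
  le_trans _ _ _ h h' := h'.trans h
  le_antisymm _ _ h h' := CompactElt.ext (le_antisymm h' h)
  inf k l := ⟨k.val ⊔ l.val, compact_sup k.isCompact l.isCompact⟩
  inf_le_left _ _ := le_sup_left
  inf_le_right _ _ := le_sup_right
  le_inf _ _ _ h h' := sup_le h h'

instance : OrderTop (CompactElt L) where
  top := ⟨⊥, isCompactElement_bot⟩
  le_top _ := bot_le

theorem isDistribMeet_compactElt [IsCompactlyGenerated L] (hL : IsFrameLattice L) :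
    IsDistribMeet (CompactElt L) := by
  intro a b c (h : c.val ≤ a.val ⊔ b.val)
  let S : Set L := {x | ∃ k l, IsCompactElement k ∧ IsCompactElement l ∧ k ≤ c.val ⊓ a.val ∧
    l ≤ c.val ⊓ b.val ∧ x = k ⊔ l}
  have hS : DirectedOn (· ≤ ·) S := by
    rintro _ ⟨k, l, hk, hl, h1, h2, rfl⟩ _ ⟨k', l', hk', hl', h1', h2', rfl⟩
    exact ⟨_, ⟨k ⊔ k', l ⊔ l', compact_sup hk hk', compact_sup hl hl', sup_le h1 h1', sup_le h2 h2', rfl⟩,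
      sup_le_sup le_sup_left le_sup_left, sup_le_sup le_sup_right le_sup_right⟩
  have hle : c.val ≤ sSup S := by
    have h1 : c.val ⊓ a.val ≤ sSup S := by
      rw [le_iff_compact_le_imp]
      exact fun k hk hka => le_sSup
        ⟨k, ⊥, hk, isCompactElement_bot, hka, bot_le, (sup_bot_eq k).symm⟩
    have h2 : c.val ⊓ b.val ≤ sSup S := by
      rw [le_iff_compact_le_imp]
      exact fun k hk hka => le_sSup
        ⟨⊥, k, isCompactElement_bot, hk, bot_le, hka, (bot_sup_eq k).symm⟩
    calc c.val = c.val ⊓ (a.val ⊔ b.val) := (inf_eq_left.2 h).symm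
      _ = _ := hL.inf_sup _ _ _
      _ ≤ _ := sup_le h1 h2
  obtain ⟨_, ⟨k, l, hk, hl, h1, h2, rfl⟩, hc⟩ :=
    (CompleteLattice.isCompactElement_iff_le_of_directed_sSup_le _ _).1 c.isCompact S
      ⟨⊥ ⊔ ⊥, ⊥, ⊥, isCompactElement_bot, isCompactElement_bot, bot_le, bot_le, rfl⟩ hS hle
  refine ⟨⟨k, hk⟩, ⟨l, hl⟩, h1.trans inf_le_right, h2.trans inf_le_right, CompactElt.ext ?_⟩
  exact le_antisymm (sup_le (h1.trans inf_le_left) (h2.trans inf_le_left)) hc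

end Compact

theorem AlgFrmJ.Hom.map_sup {L N : AlgFrmJ.{u}} (f : AlgFrmJ.Hom L N) (a b : L) :
    f.toFun (a ⊔ b) = f.toFun a ⊔ f.toFun b := by
  rw [← sSup_pair, f.map_sSup, Set.image_pair, sSup_pair]

theorem AlgFrmJ.Hom.map_bot {L N : AlgFrmJ.{u}} (f : AlgFrmJ.Hom L N) :
    f.toFun ⊥ = ⊥ := by
  rw [← sSup_empty, f.map_sSup, Set.image_empty, sSup_empty]

/-- The functor `𝓚`: it sends `L` to its compact elements under the dual order and a morphism to
its restriction. -/
def compactFunctor : AlgFrmJ.{u} ⥤ DMS.{u} where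
  obj L := { carrier := CompactElt L, distrib := isDistribMeet_compactElt L.frame }
  map {L N} f :=
    ({ toFun := fun k => ⟨f.toFun k.val, f.map_compact _ k.isCompact⟩
       map_inf' := fun k l => CompactElt.ext (f.map_sup k.val l.val)
       map_top' := CompactElt.ext f.map_bot } : InfTopHom (CompactElt L) (CompactElt N))
  map_id _ := rfl
  map_comp _ _ := rfl

/-! ### Admissible clopen upsets: the functor `𝓐` -/

section Admissible

variable {X Y : Type u} [TopologicalSpace X] [PartialOrder X] [TopologicalSpace Y] [PartialOrder Y]

theorem isClosed_Ici_of_priestley [PriestleySpace X] (x : X) : IsClosed (Set.Ici x) := by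
  rw [← isOpen_compl_iff, isOpen_iff_forall_mem_open]
  intro y hy
  obtain ⟨U, hU, hU', hx, hyU⟩ := PriestleySpace.priestley hy
  exact ⟨Uᶜ, fun z hz hxz => hz (hU' hxz hx), hU.compl.isOpen, hyU⟩

theorem exists_maximal_of_isClosed [CompactSpace X] [PriestleySpace X] {C : Set X}
    (hC : IsClosed C) {x : X} (hx : x ∈ C) : ∃ y, x ≤ y ∧ Maximal (· ∈ C) y := by
  refine zorn_le_nonempty₀ C (fun c hcC hc y hy => ?_) x hx
  haveI : Nonempty c := ⟨⟨y, hy⟩⟩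
  have hcl : ∀ i : c, IsClosed (Set.Ici (i : X) ∩ C) := fun i =>
    (isClosed_Ici_of_priestley (i : X)).inter hC
  obtain ⟨z, hz⟩ := IsCompact.nonempty_iInter_of_directed_nonempty_isCompact_isClosed
    (fun i : c => Set.Ici (i : X) ∩ C)
    (by
      rintro ⟨i, hi⟩ ⟨j, hj⟩
      rcases hc.total hi hj with h | h
      · exact ⟨⟨j, hj⟩, fun z hz => ⟨h.trans hz.1, hz.2⟩, fun z hz => hz⟩
      · exact ⟨⟨i, hi⟩, fun z hz => hz, fun z hz => ⟨h.trans hz.1, hz.2⟩⟩)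
    (fun i => ⟨i, le_rfl, hcC i.2⟩) (fun i => (hcl i).isCompact) hcl
  rw [Set.mem_iInter] at hz
  exact ⟨z, (hz ⟨y, hy⟩).2, fun i hi => (hz ⟨i, hi⟩).1⟩

theorem isAdmissible_of {X₀ U : Set X} (hU : IsClopen U) (hU' : IsUpperSet U)
    (h : ∀ x ∉ U, ∃ y ∈ X₀, y ∉ U ∧ x ≤ y) : IsAdmissible X₀ U where
  isClopen := hU
  isUpperSet := hU'
  maximal_mem x hx := by
    obtain ⟨y, hy, hyU, hxy⟩ := h x hx.1
    rwa [le_antisymm hxy (hx.2 hyU hxy)]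

theorem IsAdmissible.exists_le {X₀ U : Set X} {m : X} (h : IsPGPS X₀ m) (hU : IsAdmissible X₀ U)
    {x : X} (hx : x ∉ U) : ∃ y ∈ X₀, y ∉ U ∧ x ≤ y := by
  haveI := h.compact
  haveI := h.priestley
  obtain ⟨y, hxy, hy⟩ := exists_maximal_of_isClosed hU.isClopen.compl.isClosed (x := x) hx
  exact ⟨y, hU.maximal_mem y hy, hy.1, hxy⟩

theorem IsAdmissible.univ (X₀ : Set X) : IsAdmissible X₀ (Set.univ : Set X) where
  isClopen := isClopen_univ
  isUpperSet := isUpperSet_univ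
  maximal_mem x hx := absurd (Set.mem_univ x) hx.1

theorem IsAdmissible.inter {X₀ U V : Set X} (hU : IsAdmissible X₀ U) (hV : IsAdmissible X₀ V) :
    IsAdmissible X₀ (U ∩ V) where
  isClopen := hU.isClopen.inter hV.isClopen
  isUpperSet := hU.isUpperSet.inter hV.isUpperSet
  maximal_mem x hx := by
    by_cases hxU : x ∈ U
    · refine hV.maximal_mem x ⟨fun hxV => hx.1 ⟨hxU, hxV⟩, fun y hy hxy => ?_⟩
      exact hx.2 (fun h => hy h.2) hxy
    · refine hU.maximal_mem x ⟨hxU, fun y hy hxy => ?_⟩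
      exact hx.2 (fun h => hy h.1) hxy

/-- The admissible clopen upsets. -/
@[ext]
structure AdmClopen (X₀ : Set X) : Type u where
  carrier : Set X
  isAdmissible : IsAdmissible X₀ carrier

/-- Admissible clopen upsets are ordered by inclusion; meets are intersections. -/
instance (X₀ : Set X) : SemilatticeInf (AdmClopen X₀) where
  le U V := U.carrier ⊆ V.carrier
  le_refl _ := subset_rfl
  le_trans _ _ _ h h' := h.trans h'
  le_antisymm _ _ h h' := AdmClopen.ext (h.antisymm h')
  inf U V := ⟨U.carrier ∩ V.carrier, U.isAdmissible.inter V.isAdmissible⟩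
  inf_le_left _ _ := Set.inter_subset_left
  inf_le_right _ _ := Set.inter_subset_right
  le_inf _ _ _ h h' := Set.subset_inter h h'

instance (X₀ : Set X) : OrderTop (AdmClopen X₀) where
  top := ⟨Set.univ, IsAdmissible.univ X₀⟩
  le_top _ := Set.subset_univ _

theorem box_inter (R : X → Y → Prop) (U V : Set Y) : box R (U ∩ V) = box R U ∩ box R V := by
  ext x
  exact ⟨fun h => ⟨fun y hy => (h y hy).1, fun y hy => (h y hy).2⟩,
    fun h y hy => ⟨h.1 y hy, h.2 y hy⟩⟩

theorem box_univ (R : X → Y → Prop) : box R (Set.univ : Set Y) = Set.univ :=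
  Set.eq_univ_of_forall fun _ _ _ => Set.mem_univ _

/-! ### Admissible closed upsets: the functor `𝓥ᵃ` -/

/-- The admissible closed upsets: closed upsets `C` with `X ∖ C = ↓(X₀ ∖ C)`. -/
@[ext]
structure AdmClosed (X₀ : Set X) : Type u where
  carrier : Set X
  isClosed : IsClosed carrier
  isUpperSet : IsUpperSet carrier
  compl_eq : carrierᶜ = (lowerClosure (X₀ \ carrier) : Set X)

theorem compl_eq_lowerClosure {X₀ C : Set X} (hC : IsUpperSet C)
    (h : ∀ x ∉ C, ∃ y ∈ X₀, y ∉ C ∧ x ≤ y) : Cᶜ = (lowerClosure (X₀ \ C) : Set X) := by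
  ext x
  simp only [Set.mem_compl_iff, SetLike.mem_coe, mem_lowerClosure, Set.mem_sdiff]
  refine ⟨fun hx => ?_, fun ⟨y, hy, hxy⟩ hx => hy.2 (hC hxy hx)⟩
  obtain ⟨y, hy, hyC, hxy⟩ := h x hx
  exact ⟨y, ⟨hy, hyC⟩, hxy⟩

theorem AdmClosed.exists_le {X₀ : Set X} (C : AdmClosed X₀) {x : X} (hx : x ∉ C.carrier) :
    ∃ y ∈ X₀, y ∉ C.carrier ∧ x ≤ y := by
  have : x ∈ C.carrierᶜ := hx
  rw [C.compl_eq] at this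
  simp only [SetLike.mem_coe, mem_lowerClosure, Set.mem_sdiff] at this
  obtain ⟨y, hy, hxy⟩ := this
  exact ⟨y, hy.1, hy.2, hxy⟩

/-- Admissible closed upsets are ordered by *reverse* inclusion. -/
instance (X₀ : Set X) : PartialOrder (AdmClosed X₀) where
  le C D := D.carrier ⊆ C.carrier
  le_refl _ := subset_rfl
  le_trans _ _ _ h h' := h'.trans h
  le_antisymm _ _ h h' := AdmClosed.ext (h'.antisymm h)

theorem AdmClosed.le_def {X₀ : Set X} {C D : AdmClosed X₀} : C ≤ D ↔ D.carrier ⊆ C.carrier :=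
  Iff.rfl

/-- Joins are intersections. -/
instance (X₀ : Set X) : SupSet (AdmClosed X₀) where
  sSup S :=
    { carrier := ⋂ C ∈ S, C.carrier
      isClosed := isClosed_biInter fun C _ => C.isClosed
      isUpperSet := isUpperSet_iInter₂ fun C _ => C.isUpperSet
      compl_eq := compl_eq_lowerClosure (isUpperSet_iInter₂ fun C _ => C.isUpperSet) fun x hx => by
        simp only [Set.mem_iInter, not_forall] at hx
        obtain ⟨C, hC, hx⟩ := hx
        obtain ⟨y, hy, hyC, hxy⟩ := C.exists_le hx
        exact ⟨y, hy, fun h => hyC (Set.mem_iInter₂.1 h C hC), hxy⟩ }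

instance (X₀ : Set X) : CompleteLattice (AdmClosed X₀) :=
  completeLatticeOfSup (AdmClosed X₀) fun S =>
    ⟨fun C hC _ hx => Set.mem_iInter₂.1 hx C hC, fun _ hD _ hx => Set.mem_iInter₂.2 fun _ hC =>
      hD hC hx⟩

theorem AdmClosed.mem_sSup {X₀ : Set X} {S : Set (AdmClosed X₀)} {x : X} :
    x ∈ (sSup S).carrier ↔ ∀ C ∈ S, x ∈ C.carrier := Set.mem_iInter₂

/-- An admissible clopen upset is an admissible closed upset. -/
def AdmClosed.ofAdmissible {X₀ U : Set X} {m : X} (h : IsPGPS X₀ m) (hU : IsAdmissible X₀ U) :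
    AdmClosed X₀ where
  carrier := U
  isClosed := hU.isClopen.isClosed
  isUpperSet := hU.isUpperSet
  compl_eq := compl_eq_lowerClosure hU.isUpperSet fun _ hx => hU.exists_le h hx

theorem exists_missing_superset {X₀ : Set X} {z : X} (hz : DirectedOn (· ⊆ ·) (missing X₀ z))
    (hne : (missing X₀ z).Nonempty) {ι : Type*} (s : Finset ι) (U : ι → Set X)
    (hU : ∀ i ∈ s, U i ∈ missing X₀ z) : ∃ V ∈ missing X₀ z, ∀ i ∈ s, U i ⊆ V := by
  classical
  induction s using Finset.induction_on with
  | empty =>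
    obtain ⟨V, hV⟩ := hne
    exact ⟨V, hV, by simp⟩
  | insert a s _ ih =>
    obtain ⟨V, hV, h⟩ := ih fun i hi => hU i (Finset.mem_insert_of_mem hi)
    obtain ⟨W, hW, h1, h2⟩ := hz V hV (U a) (hU a (Finset.mem_insert_self a s))
    refine ⟨W, hW, fun i hi => ?_⟩
    rcases Finset.mem_insert.1 hi with rfl | hi
    · exact h2
    · exact (h i hi).trans h1

theorem AdmClosed.exists_admissible {X₀ : Set X} {m : X} (h : IsPGPS X₀ m) (C : AdmClosed X₀)
    {x : X} (hx : x ∉ C.carrier) : ∃ U, IsAdmissible X₀ U ∧ C.carrier ⊆ U ∧ x ∉ U := by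
  haveI := h.compact
  obtain ⟨z, hz, hzC, hxz⟩ := C.exists_le hx
  have key : ∀ c : C.carrier, ∃ U, IsAdmissible X₀ U ∧ (c : X) ∈ U ∧ z ∉ U := fun c => by
    have : ¬ (c : X) ≤ z := fun hcz => hzC (C.isUpperSet hcz c.2)
    rw [h.le_iff] at this
    push Not at this
    exact this
  choose U hU hcU hzU using key
  obtain ⟨t, ht⟩ := C.isClosed.isCompact.elim_finite_subcover U
    (fun c => (hU c).isClopen.isOpen) (fun c hc => Set.mem_iUnion.2 ⟨⟨c, hc⟩, hcU ⟨c, hc⟩⟩)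
  obtain ⟨hne, hdir⟩ := (h.mem_iff z).1 hz
  obtain ⟨V, hV, hVU⟩ := exists_missing_superset hdir hne t U fun i _ => ⟨hU i, hzU i⟩
  refine ⟨V, hV.1, fun c hc => ?_, fun hxV => hV.2 (hV.1.isUpperSet hxz hxV)⟩
  obtain ⟨i, hi, hci⟩ := Set.mem_iUnion₂.1 (ht hc)
  exact hVU i hi hci

theorem AdmClosed.isCompactElement_iff {X₀ : Set X} {m : X} (h : IsPGPS X₀ m)
    {C : AdmClosed X₀} : IsCompactElement C ↔ IsAdmissible X₀ C.carrier := by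
  haveI := h.compact
  rw [CompleteLattice.isCompactElement_iff_le_of_directed_sSup_le]
  refine ⟨fun hC => ?_, fun hC S hne hS hle => ?_⟩
  · obtain ⟨U, ⟨hU, hCU⟩, hle⟩ := hC {U | IsAdmissible X₀ U.carrier ∧ C.carrier ⊆ U.carrier}
      ⟨ofAdmissible h (.univ X₀), .univ X₀, Set.subset_univ _⟩
      (fun U hU V hV => ⟨ofAdmissible h (hU.1.inter hV.1),
        ⟨hU.1.inter hV.1, Set.subset_inter hU.2 hV.2⟩, Set.inter_subset_left,
        Set.inter_subset_right⟩)
      (fun x hx => by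
        by_contra hxC
        obtain ⟨U, hU, hCU, hxU⟩ := C.exists_admissible h hxC
        exact hxU (mem_sSup.1 hx (ofAdmissible h hU) ⟨hU, hCU⟩))
    have : C = U := le_antisymm hle hCU
    rwa [this]
  · haveI : Nonempty S := hne.to_subtype
    obtain ⟨D, hD⟩ := exists_subset_nhds_of_isCompact' (V := fun D : S => D.1.carrier)
      (by
        rintro ⟨D, hD⟩ ⟨E, hE⟩
        obtain ⟨G, hG, h1, h2⟩ := hS D hD E hE
        exact ⟨⟨G, hG⟩, h1, h2⟩)
      (fun D => D.1.isClosed.isCompact) (fun D => D.1.isClosed) (U := C.carrier)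
      (fun x hx => hC.isClopen.isOpen.mem_nhds (hle (mem_sSup.2 fun D hD =>
        Set.mem_iInter.1 hx ⟨D, hD⟩)))
    exact ⟨D.1, D.2, hD⟩

theorem AdmClosed.isCompactlyGenerated {X₀ : Set X} {m : X} (h : IsPGPS X₀ m) :
    IsCompactlyGenerated (AdmClosed X₀) where
  exists_sSup_eq C := by
    refine ⟨{U | IsAdmissible X₀ U.carrier ∧ C.carrier ⊆ U.carrier},
      fun U hU => (isCompactElement_iff h).2 hU.1,
      le_antisymm (sSup_le fun U hU => hU.2) fun x hx => ?_⟩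
    by_contra hxC
    obtain ⟨U, hU, hCU, hxU⟩ := C.exists_admissible h hxC
    exact hxU (mem_sSup.1 hx (ofAdmissible h hU) ⟨hU, hCU⟩)

theorem AdmClosed.isFrameLattice {X₀ : Set X} {m : X} (h : IsPGPS X₀ m) :
    IsFrameLattice (AdmClosed X₀) := by
  intro C S
  refine le_antisymm ?_ (iSup₂_le fun D hD => inf_le_inf_left _ (le_sSup hD))
  intro x hx
  by_contra hxC
  obtain ⟨y, hy, hyC, hxy⟩ := (C ⊓ sSup S).exists_le hxC
  have hy1 : y ∉ C.carrier := fun h' => hyC ((inf_le_left : C ⊓ sSup S ≤ C) h')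
  have hy2 : y ∉ (sSup S).carrier := fun h' => hyC ((inf_le_right : C ⊓ sSup S ≤ sSup S) h')
  rw [mem_sSup] at hy2
  push Not at hy2
  obtain ⟨D, hD, hyD⟩ := hy2
  obtain ⟨U, hU, hCU, hyU⟩ := C.exists_admissible h hy1
  obtain ⟨V, hV, hDV, hyV⟩ := D.exists_admissible h hyD
  obtain ⟨W, hW, hUW, hVW⟩ := ((h.mem_iff y).1 hy).2 U ⟨hU, hyU⟩ V ⟨hV, hyV⟩
  have h1 : ofAdmissible h hW.1 ≤ C ⊓ D := le_inf (hCU.trans hUW) (hDV.trans hVW)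
  have h2 : C ⊓ D ≤ ⨆ s ∈ S, C ⊓ s := le_iSup₂_of_le D hD le_rfl
  exact hW.2 (hW.1.isUpperSet hxy (h1 (h2 hx)))

theorem isDistribMeet_admClopen {X₀ : Set X} {m : X} (h : IsPGPS X₀ m) :
    IsDistribMeet (AdmClopen X₀) := by
  intro U V W hUVW
  haveI := AdmClosed.isCompactlyGenerated h
  let f : AdmClopen X₀ → CompactElt (AdmClosed X₀) := fun U =>
    ⟨AdmClosed.ofAdmissible h U.isAdmissible, (AdmClosed.isCompactElement_iff h).2 U.isAdmissible⟩
  have hinf : ∀ C D : AdmClosed X₀, (C ⊔ D).carrier = C.carrier ∩ D.carrier := fun C D => by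
    ext x
    rw [← sSup_pair, AdmClosed.mem_sSup]
    simp
  obtain ⟨a, b, ha, hb, hab⟩ := isDistribMeet_compactElt (AdmClosed.isFrameLattice h)
    (f U) (f V) (f W) (by
      show (f W).val ≤ (f U).val ⊔ (f V).val
      rw [AdmClosed.le_def, hinf]
      exact hUVW)
  refine ⟨⟨a.val.carrier, (AdmClosed.isCompactElement_iff h).1 a.isCompact⟩,
    ⟨b.val.carrier, (AdmClosed.isCompactElement_iff h).1 b.isCompact⟩, ha, hb, ?_⟩
  apply AdmClopen.ext
  have := congrArg (fun k : CompactElt (AdmClosed X₀) => k.val.carrier) hab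
  exact (hinf a.val b.val).symm.trans this

/-- `□_R` on admissible closed upsets. -/
def AdmClosed.box {X₀ : Set X} {Y₀ : Set Y} {m : X} {n : Y} (hX : IsPGPS X₀ m) (hY : IsPGPS Y₀ n)
    {R : X → Y → Prop} (hR : IsGPMorphism X₀ Y₀ R) (C : AdmClosed Y₀) : AdmClosed X₀ :=
  have key : GenPriestley.box R C.carrier = (sSup {D : AdmClosed X₀ | ∃ U, IsAdmissible Y₀ U ∧
      C.carrier ⊆ U ∧ D.carrier = GenPriestley.box R U}).carrier := by
    ext x
    rw [mem_sSup]
    constructor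
    · rintro hx D ⟨U, -, hCU, hD⟩
      rw [hD]
      exact fun y hy => hCU (hx y hy)
    · intro hx y hy
      by_contra hyC
      obtain ⟨U, hU, hCU, hyU⟩ := C.exists_admissible hY hyC
      exact hyU (hx (ofAdmissible hX (hR.box_admissible U hU)) ⟨U, hU, hCU, rfl⟩ y hy)
  { carrier := GenPriestley.box R C.carrier
    isClosed := key ▸ AdmClosed.isClosed _
    isUpperSet := key ▸ AdmClosed.isUpperSet _
    compl_eq := key ▸ AdmClosed.compl_eq _ }

end Admissible

/-- The contravariant functor `𝓐`: it sends `X` to its admissible clopen upsets and `R` to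
`□_R`. -/
def admFunctor : PGPS.{u}ᵒᵖ ⥤ DMS.{u} where
  obj X := { carrier := AdmClopen X.unop.dom, distrib := isDistribMeet_admClopen X.unop.isPGPS }
  map {Y X} R :=
    ({ toFun := fun U => ⟨box R.unop.rel U.carrier,
          R.unop.isGPMorphism.box_admissible _ U.isAdmissible⟩
       map_inf' := fun U V => AdmClopen.ext (box_inter _ _ _)
       map_top' := AdmClopen.ext (box_univ _) } :
      InfTopHom (AdmClopen Y.unop.dom) (AdmClopen X.unop.dom))
  map_id X := DFunLike.ext (F := InfTopHom (AdmClopen X.unop.dom) (AdmClopen X.unop.dom)) _ _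
    fun U => AdmClopen.ext (box_le U.isAdmissible.isUpperSet)
  map_comp {X _ Z} R S :=
    DFunLike.ext (F := InfTopHom (AdmClopen X.unop.dom) (AdmClopen Z.unop.dom)) _ _
      fun U => AdmClopen.ext (box_starComp _ _ U.isAdmissible)

/-- The contravariant functor `𝓥ᵃ`: it sends `X` to its admissible closed upsets and `R` to
`□_R`. -/
def vietorisFunctor : PGPS.{u}ᵒᵖ ⥤ AlgFrmJ.{u} where
  obj X :=
    { carrier := AdmClosed X.unop.dom
      algebraic := AdmClosed.isCompactlyGenerated X.unop.isPGPS
      frame := AdmClosed.isFrameLattice X.unop.isPGPS }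
  map {Y X} R :=
    { toFun := AdmClosed.box X.unop.isPGPS Y.unop.isPGPS R.unop.isGPMorphism
      map_sSup := fun S => by
        apply AdmClosed.ext
        ext x
        rw [AdmClosed.mem_sSup]
        constructor
        · rintro hx _ ⟨C, hC, rfl⟩ y hy
          exact AdmClosed.mem_sSup.1 (hx y hy) C hC
        · intro hx y hy
          exact AdmClosed.mem_sSup.2 fun C hC => hx _ ⟨C, hC, rfl⟩ y hy
      map_compact := fun C hC => (AdmClosed.isCompactElement_iff X.unop.isPGPS).2
        (R.unop.isGPMorphism.box_admissible _
          ((AdmClosed.isCompactElement_iff Y.unop.isPGPS).1 hC)) }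
  map_id X := by
    apply AlgFrmJ.Hom.ext
    funext C
    exact AdmClosed.ext (box_le (AdmClosed.isUpperSet C))
  map_comp {X Y Z} R S := by
    apply AlgFrmJ.Hom.ext
    funext C
    apply AdmClosed.ext
    ext z
    constructor
    · intro hz y hy x hx
      exact hz x (starComp_of hy hx)
    · intro hz x hx
      by_contra hxC
      obtain ⟨U, hU, hCU, hxU⟩ := AdmClosed.exists_admissible X.unop.isPGPS C hxC
      exact hxU (hx U hU fun y hy x hx => hCU (hz y hy x hx))

/-! ### Pseudoprime elements: the functor `𝓨` -/

section Pseudoprime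

variable {L N : Type u} [CompleteLattice L] [CompleteLattice N]

/-- The way-below relation. -/
def WayBelow (a b : L) : Prop :=
  ∀ S : Set L, b ≤ sSup S → ∃ T ⊆ S, T.Finite ∧ a ≤ sSup T

/-- Pseudoprime elements: `p ≠ 1` and `a₁ ∧ ⋯ ∧ aₙ ≪ p` implies `aᵢ ≤ p` for some `i`. -/
def IsPseudoprime (p : L) : Prop :=
  p ≠ ⊤ ∧ ∀ A : Finset L, WayBelow (A.inf id) p → ∃ a ∈ A, a ≤ p

theorem WayBelow.le {a b : L} (h : WayBelow a b) : a ≤ b := by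
  obtain ⟨T, hT, -, ha⟩ := h {b} (by simp)
  exact ha.trans (sSup_le fun x hx => (hT hx).le)

theorem wayBelow_of_le_compact {a k b : L} (hk : IsCompactElement k) (h : a ≤ k) (h' : k ≤ b) :
    WayBelow a b := by
  intro S hS
  obtain ⟨T, hT, hk⟩ := (CompleteLattice.isCompactElement_iff_exists_le_sSup_of_le_sSup _ k).1 hk S
    (h'.trans hS)
  exact ⟨T, hT, T.finite_toSet, h.trans (by rwa [Finset.sup_id_eq_sSup] at hk)⟩

theorem WayBelow.exists_compact [IsCompactlyGenerated L] {a b : L} (h : WayBelow a b) :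
    ∃ k, IsCompactElement k ∧ a ≤ k ∧ k ≤ b := by
  obtain ⟨T, hT, hfin, ha⟩ := h {k | IsCompactElement k ∧ k ≤ b} (sSup_compact_le_eq b).ge
  refine ⟨sSup T, ?_, ha, sSup_le fun x hx => (hT hx).2⟩
  have := CompleteLattice.isCompactElement_finsetSup (f := id) hfin.toFinset
    (fun x hx => (hT (hfin.mem_toFinset.1 hx)).1)
  rwa [Finset.sup_id_eq_sSup, hfin.coe_toFinset] at this

theorem infPrime_finset {p : L} (hp : InfPrime p) {A : Finset L} (h : A.inf id ≤ p) :
    ∃ a ∈ A, a ≤ p := by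
  classical
  induction A using Finset.induction_on with
  | empty => exact absurd (isMax_iff_eq_top.2 (top_le_iff.1 h)) hp.1
  | insert a A _ ih =>
    rw [Finset.inf_insert] at h
    rcases hp.2 h with h | h
    · exact ⟨a, Finset.mem_insert_self a A, h⟩
    · obtain ⟨b, hb, hbp⟩ := ih h
      exact ⟨b, Finset.mem_insert_of_mem hb, hbp⟩

theorem infPrime_ne_top {p : L} (hp : InfPrime p) : p ≠ ⊤ := fun h => hp.1 (isMax_iff_eq_top.2 h)

theorem IsPseudoprime.of_infPrime {p : L} (hp : InfPrime p) : IsPseudoprime p :=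
  ⟨infPrime_ne_top hp, fun _ h => infPrime_finset hp h.le⟩

/-- In an algebraic frame, distinct elements are separated by primes. -/
theorem exists_infPrime [IsCompactlyGenerated L] (hL : IsFrameLattice L) {a b : L}
    (hab : ¬ a ≤ b) : ∃ p, InfPrime p ∧ b ≤ p ∧ ¬ a ≤ p := by
  obtain ⟨k, hk, hka, hkb⟩ := exists_compact_not_le hab
  obtain ⟨p, hbp, hp⟩ := zorn_le_nonempty₀ {x : L | ¬ k ≤ x} (fun c hc hchain y hy => by
    refine ⟨sSup c, fun hkc => ?_, fun z hz => le_sSup hz⟩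
    obtain ⟨x, hx, hkx⟩ := (CompleteLattice.isCompactElement_iff_le_of_directed_sSup_le _ _).1 hk c
      ⟨y, hy⟩ hchain.directedOn hkc
    exact hc hx hkx) b hkb
  have hkp : ¬ k ≤ p := hp.1
  refine ⟨p, ⟨fun hmax => hkp ((isMax_iff_eq_top.1 hmax).symm ▸ le_top), fun x y hxy => ?_⟩, hbp,
    fun hap => hkp (hka.trans hap)⟩
  by_contra! hcon
  have aux : ∀ z, ¬ z ≤ p → k ≤ p ⊔ z := fun z hz => by
    by_contra hkz
    exact hz (le_sup_right.trans (hp.2 hkz le_sup_left))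
  exact hkp (((le_inf (aux x hcon.1) (aux y hcon.2)).trans (hL.sup_inf_le p x y)).trans
    (sup_le le_rfl hxy))

/-- The topology on an algebraic lattice generated by the sets `↑k` and their complements,
for `k` compact. -/
@[reducible]
def patchTopology (L : Type u) [CompleteLattice L] : TopologicalSpace L :=
  TopologicalSpace.generateFrom
    ({U | ∃ k, IsCompactElement k ∧ U = Set.Ici k} ∪
      {U | ∃ k, IsCompactElement k ∧ U = (Set.Ici k)ᶜ})

/-- `Y_L`: the pseudoprime elements together with the top. -/
def ySet (L : Type u) [CompleteLattice L] : Set L := {p | IsPseudoprime p} ∪ {⊤}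

/-- `Y_L` carries the subspace topology. -/
instance : TopologicalSpace (ySet L) := (patchTopology L).induced Subtype.val

/-- `P(L)`, as a subset of `Y_L`. -/
def yPrimes (L : Type u) [CompleteLattice L] : Set (ySet L) := {p | InfPrime p.1}

/-- The point `1` of `Y_L`. -/
def yTop (L : Type u) [CompleteLattice L] : ySet L := ⟨⊤, Or.inr rfl⟩

theorem isOpen_up {k : L} (hk : IsCompactElement k) : IsOpen {y : ySet L | k ≤ y.1} :=
  letI := patchTopology L
  ⟨Set.Ici k, .basic _ (Or.inl ⟨k, hk, rfl⟩), rfl⟩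

theorem isClopen_up {k : L} (hk : IsCompactElement k) : IsClopen {y : ySet L | k ≤ y.1} :=
  letI := patchTopology L
  ⟨⟨⟨(Set.Ici k)ᶜ, .basic _ (Or.inr ⟨k, hk, rfl⟩), rfl⟩⟩, isOpen_up hk⟩

theorem isUpperSet_up (a : L) : IsUpperSet {y : ySet L | a ≤ y.1} := fun _ _ h h' => le_trans h' h

/-- Basic neighbourhoods in the patch topology. -/
theorem exists_basic_nhds {U : Set L} (hU : @IsOpen L (patchTopology L) U) {q : L} (hq : q ∈ U) :
    ∃ t, IsCompactElement t ∧ t ≤ q ∧ ∃ F : Finset L, (∀ l ∈ F, IsCompactElement l ∧ ¬ l ≤ q) ∧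
      ∀ x, t ≤ x → (∀ l ∈ F, ¬ l ≤ x) → x ∈ U := by
  classical
  change TopologicalSpace.GenerateOpen _ U at hU
  induction hU with
  | basic s hs =>
    rcases hs with ⟨k, hk, rfl⟩ | ⟨k, hk, rfl⟩
    · exact ⟨k, hk, hq, ∅, by simp, fun x hx _ => hx⟩
    · exact ⟨⊥, isCompactElement_bot, bot_le, {k}, by simpa using ⟨hk, hq⟩,
        fun x _ hx => hx k (by simp)⟩
  | univ => exact ⟨⊥, isCompactElement_bot, bot_le, ∅, by simp, fun x _ _ => trivial⟩
  | inter s t _ _ ihs iht =>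
    obtain ⟨a, ha, haq, F, hF, h⟩ := ihs hq.1
    obtain ⟨b, hb, hbq, G, hG, h'⟩ := iht hq.2
    refine ⟨a ⊔ b, compact_sup ha hb, sup_le haq hbq, F ∪ G, fun l hl => ?_, fun x hx hl => ?_⟩
    · rcases Finset.mem_union.1 hl with hl | hl
      exacts [hF l hl, hG l hl]
    · exact ⟨h x (le_sup_left.trans hx) fun l hl' => hl l (Finset.mem_union_left _ hl'),
        h' x (le_sup_right.trans hx) fun l hl' => hl l (Finset.mem_union_right _ hl')⟩
  | sUnion S _ ih =>
    obtain ⟨s, hs, hqs⟩ := hq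
    obtain ⟨a, ha, haq, F, hF, h⟩ := ih s hs hqs
    exact ⟨a, ha, haq, F, hF, fun x hx hl => ⟨s, hs, h x hx hl⟩⟩

theorem exists_basic_nhds_ySet {U : Set (ySet L)} (hU : IsOpen U) {q : ySet L} (hq : q ∈ U) :
    ∃ t, IsCompactElement t ∧ t ≤ q.1 ∧ ∃ F : Finset L,
      (∀ l ∈ F, IsCompactElement l ∧ ¬ l ≤ q.1) ∧
        ∀ x : ySet L, t ≤ x.1 → (∀ l ∈ F, ¬ l ≤ x.1) → x ∈ U := by
  obtain ⟨V, hV, rfl⟩ := hU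
  obtain ⟨t, ht, htq, F, hF, h⟩ := exists_basic_nhds hV hq
  exact ⟨t, ht, htq, F, hF, fun x hx hl => h x.1 hx hl⟩

theorem compactSpace_ySet [IsCompactlyGenerated L] : CompactSpace (ySet L) := by
  rw [← isCompact_univ_iff, isCompact_iff_ultrafilter_le_nhds]
  intro 𝓕 _
  let D : Set L := {k | IsCompactElement k ∧ {y : ySet L | k ≤ y.1} ∈ 𝓕}
  have hD : DirectedOn (· ≤ ·) D := fun a ha b hb => ⟨a ⊔ b, ⟨compact_sup ha.1 hb.1, by
    filter_upwards [ha.2, hb.2] with y h1 h2 using sup_le h1 h2⟩, le_sup_left, le_sup_right⟩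
  have hDne : D.Nonempty := ⟨⊥, isCompactElement_bot, 
    Filter.univ_mem' (f := (𝓕 : Filter (ySet L))) fun _ => bot_le⟩
  have hmem : ∀ k, IsCompactElement k → (k ≤ sSup D ↔ {y : ySet L | k ≤ y.1} ∈ 𝓕) := by
    refine fun k hk => ⟨fun h => ?_, fun h => le_sSup ⟨hk, h⟩⟩
    obtain ⟨l, hl, hkl⟩ :=
      (CompleteLattice.isCompactElement_iff_le_of_directed_sSup_le _ _).1 hk D hDne hD h
    filter_upwards [hl.2] with y hy using hkl.trans hy
  have hmem' : ∀ k, IsCompactElement k → ¬ k ≤ sSup D → {y : ySet L | ¬ k ≤ y.1} ∈ 𝓕 := by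
    intro k hk h
    rw [hmem k hk] at h
    exact Ultrafilter.compl_mem_iff_notMem.2 h
  have hp : sSup D ∈ ySet L := by
    by_cases htop : sSup D = ⊤
    · exact Or.inr htop
    refine Or.inl ⟨htop, fun A hA => ?_⟩
    by_contra! hcon
    obtain ⟨t, ht, hAt, htp⟩ := hA.exists_compact
    have hk : ∀ a : A, ∃ k, IsCompactElement k ∧ k ≤ a.1 ∧ ¬ k ≤ sSup D := fun a =>
      exists_compact_not_le (hcon a.1 a.2)
    choose k hkc hka hkp using hk
    have hall : {y : ySet L | ∀ a : A, ¬ k a ≤ y.1} ∈ 𝓕 := by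
      have := (Filter.iInter_mem (f := (𝓕 : Filter (ySet L)))).2 fun a => hmem' (k a) (hkc a) (hkp a)
      exact Filter.mem_of_superset this fun y hy a => Set.mem_iInter.1 hy a
    obtain ⟨y, hty, hy⟩ := 𝓕.nonempty_of_mem (Filter.inter_mem ((hmem t ht).1 htp) hall)
    classical
    have hle : (Finset.univ.image k).inf id ≤ t := by
      refine le_trans (Finset.le_inf fun a ha => ?_) hAt
      have h1 : (Finset.univ.image k).inf id ≤ id (k ⟨a, ha⟩) :=
        Finset.inf_le (Finset.mem_image_of_mem k (Finset.mem_univ _))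
      exact h1.trans (hka ⟨a, ha⟩)
    rcases y.2 with hyp | hyp
    · obtain ⟨_, hb, hby⟩ := hyp.2 _ (wayBelow_of_le_compact ht hle hty)
      obtain ⟨a, -, rfl⟩ := Finset.mem_image.1 hb
      exact hy a hby
    · rcases A.eq_empty_or_nonempty with rfl | ⟨a, ha⟩
      · exact htop (top_le_iff.1 (hAt.trans htp))
      · exact hy ⟨a, ha⟩ (le_of_le_of_eq le_top hyp.symm)
  refine ⟨⟨sSup D, hp⟩, trivial, fun U hU => ?_⟩
  obtain ⟨V, hVU, hV, hpV⟩ := mem_nhds_iff.1 hU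
  obtain ⟨t, ht, htp, F, hF, h⟩ := exists_basic_nhds_ySet hV hpV
  have hFmem : (⋂ l ∈ F, {y : ySet L | ¬ l ≤ y.1}) ∈ (𝓕 : Filter (ySet L)) :=
    (Filter.biInter_finset_mem F).2 fun l hl => hmem' l (hF l hl).1 (hF l hl).2
  refine Filter.mem_of_superset (Filter.inter_mem ((hmem t ht).1 htp) hFmem) fun y hy => hVU ?_
  exact h y hy.1 fun l hl => Set.mem_iInter₂.1 hy.2 l hl

theorem priestleySpace_ySet [IsCompactlyGenerated L] : PriestleySpace (ySet L) where
  priestley {x y} h := by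
    obtain ⟨k, hk, hkx, hky⟩ := exists_compact_not_le (show ¬ x.1 ≤ y.1 from h)
    exact ⟨_, isClopen_up hk, isUpperSet_up k, hkx, hky⟩

/-- If an open set contains `↑c ∩ Y_L` then it contains `↑t ∩ Y_L` for some compact `t ≤ c`. -/
theorem exists_compact_up_subset [IsCompactlyGenerated L] (c : L) {U : Set (ySet L)}
    (hU : IsOpen U) (h : ∀ y : ySet L, c ≤ y.1 → y ∈ U) :
    ∃ t, IsCompactElement t ∧ t ≤ c ∧ ∀ y : ySet L, t ≤ y.1 → y ∈ U := by
  have := compactSpace_ySet (L := L)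
  have : Nonempty {k : L | IsCompactElement k ∧ k ≤ c} := ⟨⟨⊥, isCompactElement_bot, bot_le⟩⟩
  obtain ⟨k, hk⟩ := exists_subset_nhds_of_isCompact'
    (V := fun k : {k : L | IsCompactElement k ∧ k ≤ c} => {y : ySet L | k.1 ≤ y.1})
    (by
      rintro ⟨a, ha⟩ ⟨b, hb⟩
      obtain ⟨d, hd, h1, h2⟩ := directedOn_compact_le c a ha b hb
      exact ⟨⟨d, hd⟩, fun y hy => h1.trans hy, fun y hy => h2.trans hy⟩)
    (fun k => (isClopen_up k.2.1).isClosed.isCompact) (fun k => (isClopen_up k.2.1).isClosed)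
    (U := U) (fun y hy => hU.mem_nhds (h y (by
      rw [le_iff_compact_le_imp]
      exact fun k hk hkc => Set.mem_iInter.1 hy ⟨k, hk, hkc⟩)))
  exact ⟨k.1, k.2.1, k.2.2, hk⟩

theorem isAdmissible_up [IsCompactlyGenerated L] (hL : IsFrameLattice L) {k : L}
    (hk : IsCompactElement k) : IsAdmissible (yPrimes L) {y : ySet L | k ≤ y.1} :=
  isAdmissible_of (isClopen_up hk) (isUpperSet_up k) fun x hx => by
    obtain ⟨p, hp, hxp, hkp⟩ := exists_infPrime hL hx
    exact ⟨⟨p, Or.inl (.of_infPrime hp)⟩, hp, hkp, hxp⟩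

theorem isAdmissible_ySet_iff [IsCompactlyGenerated L] (hL : IsFrameLattice L)
    {U : Set (ySet L)} :
    IsAdmissible (yPrimes L) U ↔ ∃ k, IsCompactElement k ∧ U = {y : ySet L | k ≤ y.1} := by
  classical
  refine ⟨fun hU => ?_, ?_⟩
  · have := compactSpace_ySet (L := L)
    have := priestleySpace_ySet (L := L)
    have key : ∀ u : U, ∃ k, IsCompactElement k ∧ k ≤ u.1.1 ∧ ∀ y : ySet L, k ≤ y.1 → y ∈ U :=
      fun u => exists_compact_up_subset u.1.1 hU.isClopen.isOpen
        fun y hy => hU.isUpperSet (show u.1 ≤ y from hy) u.2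
    choose k hk hku hkU using key
    obtain ⟨s, hs⟩ := hU.isClopen.isClosed.isCompact.elim_finite_subcover
      (fun u : U => {y : ySet L | k u ≤ y.1}) (fun u => isOpen_up (hk u))
      (fun u hu => Set.mem_iUnion.2 ⟨⟨u, hu⟩, hku ⟨u, hu⟩⟩)
    have hinf : ∀ y : ySet L, s.inf k ≤ y.1 → y ∈ U := by
      intro y hy
      by_contra hyU
      obtain ⟨p, hyp, hp⟩ := exists_maximal_of_isClosed hU.isClopen.compl.isClosed (x := y) hyU
      have hprime : InfPrime p.1 := hU.maximal_mem p hp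
      obtain ⟨b, hb, hbp⟩ := infPrime_finset (A := s.image k) hprime (by
        rw [Finset.inf_image]
        exact hy.trans hyp)
      obtain ⟨u, -, rfl⟩ := Finset.mem_image.1 hb
      exact hp.1 (hkU u p hbp)
    obtain ⟨t, ht, hts, h⟩ := exists_compact_up_subset (s.inf k) hU.isClopen.isOpen hinf
    refine ⟨t, ht, Set.Subset.antisymm (fun y hy => ?_) h⟩
    obtain ⟨u, hu, huy⟩ := Set.mem_iUnion₂.1 (hs hy)
    exact (hts.trans (Finset.inf_le hu)).trans huy
  · rintro ⟨k, hk, rfl⟩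
    exact isAdmissible_up hL hk

theorem isPGPS_ySet [IsCompactlyGenerated L] (hL : IsFrameLattice L) :
    IsPGPS (yPrimes L) (yTop L) where
  compact := compactSpace_ySet
  priestley := priestleySpace_ySet
  isTop y := show y.1 ≤ ⊤ from le_top
  subset := by
    rintro p hp rfl
    exact infPrime_ne_top hp rfl
  dense := by
    classical
    intro q hq
    rw [mem_closure_iff]
    intro U hU hqU
    obtain ⟨t, ht, htq, F, hF, h⟩ := exists_basic_nhds_ySet hU hqU
    have hqp : IsPseudoprime q.1 := by
      rcases q.2 with h | h
      · exact h
      · exact absurd (Subtype.ext (show q.1 = (yTop L).1 from h)) hq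
    have hnot : ¬ F.inf id ≤ t := fun hle => by
      obtain ⟨l, hl, hlq⟩ := hqp.2 F (wayBelow_of_le_compact ht hle htq)
      exact (hF l hl).2 hlq
    obtain ⟨p, hp, htp, hFp⟩ := exists_infPrime hL hnot
    exact ⟨⟨p, Or.inl (.of_infPrime hp)⟩, h _ htp fun l hl hlp => hFp ((Finset.inf_le hl).trans hlp),
      hp⟩
  order_dense x hx := by
    have : ¬ ⊤ ≤ x.1 := fun h => hx (Subtype.ext (top_le_iff.1 h))
    obtain ⟨p, hp, hxp, -⟩ := exists_infPrime hL this
    exact ⟨⟨p, Or.inl (.of_infPrime hp)⟩, hp, hxp⟩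
  mem_iff x := by
    constructor
    · intro hx
      have hx' : InfPrime x.1 := hx
      constructor
      · obtain ⟨k, hk, -, hkx⟩ :=
          exists_compact_not_le (fun h => infPrime_ne_top hx' (top_le_iff.1 h) : ¬ ⊤ ≤ x.1)
        exact ⟨_, isAdmissible_up hL hk, hkx⟩
      · rintro U ⟨hU, hxU⟩ V ⟨hV, hxV⟩
        obtain ⟨k, hk, rfl⟩ := (isAdmissible_ySet_iff hL).1 hU
        obtain ⟨l, hl, rfl⟩ := (isAdmissible_ySet_iff hL).1 hV
        have : ¬ k ⊓ l ≤ x.1 := fun h => (hx'.2 h).elim hxU hxV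
        obtain ⟨t, ht, htkl, htx⟩ := exists_compact_not_le this
        exact ⟨_, ⟨isAdmissible_up hL ht, htx⟩, fun y hy => (htkl.trans inf_le_left).trans hy,
          fun y hy => (htkl.trans inf_le_right).trans hy⟩
    · rintro ⟨⟨U, hU, hxU⟩, hdir⟩
      refine ⟨fun hmax => hxU ?_, fun a b hab => ?_⟩
      · obtain ⟨k, hk, rfl⟩ := (isAdmissible_ySet_iff hL).1 hU
        exact (le_top : k ≤ ⊤).trans (isMax_iff_eq_top.1 hmax).ge
      · by_contra! hcon
        obtain ⟨k, hk, hka, hkx⟩ := exists_compact_not_le hcon.1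
        obtain ⟨l, hl, hlb, hlx⟩ := exists_compact_not_le hcon.2
        obtain ⟨W, ⟨hW, hxW⟩, h1, h2⟩ := hdir _ ⟨isAdmissible_up hL hk, hkx⟩ _
          ⟨isAdmissible_up hL hl, hlx⟩
        obtain ⟨t, ht, rfl⟩ := (isAdmissible_ySet_iff hL).1 hW
        have aux : ∀ k : L, {y : ySet L | k ≤ y.1} ⊆ {y : ySet L | t ≤ y.1} → t ≤ k := by
          intro k hsub
          by_contra htk
          obtain ⟨p, hp, hkp, htp⟩ := exists_infPrime hL htk
          exact htp (hsub (show k ≤ (⟨p, Or.inl (.of_infPrime hp)⟩ : ySet L).1 from hkp))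
        exact hxW ((le_inf ((aux k h1).trans hka) ((aux l h2).trans hlb)).trans hab)
  le_iff x y := by
    refine ⟨fun h U hU hx => hU.isUpperSet h hx, fun h => ?_⟩
    show x.1 ≤ y.1
    rw [le_iff_compact_le_imp]
    exact fun k hk hkx => h _ (isAdmissible_up hL hk) hkx

/-- The right adjoint of a join-preserving map. -/
def rightAdj (f : L → N) (b : N) : L := sSup {a | f a ≤ b}

/-- The relation `R_α ⊆ Y_N × Y_L` of `α : L → N`: `p R_α q` iff `r(p) ≤ q`, where `r` is the right
adjoint of `α`. -/
def yRel (f : L → N) (p : ySet N) (q : ySet L) : Prop := rightAdj f p.1 ≤ q.1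

theorem gc_rightAdj {f : L → N} (hf : ∀ S : Set L, f (sSup S) = sSup (f '' S)) :
    GaloisConnection f (rightAdj f) := by
  have hmono : Monotone f := fun a b hab => by
    have := hf {a, b}
    rw [sSup_pair, sup_eq_right.2 hab, Set.image_pair, sSup_pair] at this
    rw [this]
    exact le_sup_left
  intro a b
  refine ⟨fun h => le_sSup h, fun h => (hmono h).trans ?_⟩
  rw [rightAdj, hf]
  exact sSup_le (by rintro _ ⟨c, hc, rfl⟩; exact hc)

theorem box_yRel [IsCompactlyGenerated L] (hL : IsFrameLattice L) {f : L → N}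
    (hf : ∀ S : Set L, f (sSup S) = sSup (f '' S)) (k : L) :
    box (yRel f) {y : ySet L | k ≤ y.1} = {y : ySet N | f k ≤ y.1} := by
  ext p
  constructor
  · intro h
    show f k ≤ p.1
    rw [gc_rightAdj hf k p.1]
    by_contra hcon
    obtain ⟨q, hq, hpq, hkq⟩ := exists_infPrime hL hcon
    exact hkq (h ⟨q, Or.inl (.of_infPrime hq)⟩ hpq)
  · intro h q hq
    exact ((gc_rightAdj hf k p.1).1 h).trans hq

theorem isGPMorphism_yRel [IsCompactlyGenerated L] [IsCompactlyGenerated N]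
    (hL : IsFrameLattice L) (hN : IsFrameLattice N) {f : L → N}
    (hf : ∀ S : Set L, f (sSup S) = sSup (f '' S))
    (hf' : ∀ k, IsCompactElement k → IsCompactElement (f k)) :
    IsGPMorphism (yPrimes N) (yPrimes L) (yRel f) where
  separated p q h := by
    obtain ⟨k, hk, hkp, hkq⟩ := exists_compact_not_le h
    exact ⟨_, isAdmissible_up hL hk, fun z hz => hkp.trans hz, hkq⟩
  box_admissible U hU := by
    obtain ⟨k, hk, rfl⟩ := (isAdmissible_ySet_iff hL).1 hU
    rw [box_yRel hL hf]
    exact isAdmissible_up hN (hf' k hk)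

end Pseudoprime

/-- The contravariant functor `𝓨`: it sends `L` to `⟨Y_L, τ, ≤, P(L), 1⟩` and `α` to `R_α`. -/
def yFunctor : AlgFrmJ.{u} ⥤ PGPS.{u}ᵒᵖ where
  obj L := .op
    { carrier := ySet L
      dom := yPrimes L
      pt := yTop L
      isPGPS := isPGPS_ySet L.frame }
  map {L N} f := Quiver.Hom.op
    ({ rel := yRel f.toFun
       isGPMorphism := isGPMorphism_yRel L.frame N.frame f.map_sSup f.map_compact } : PGPS.Hom _ _)
  map_id L := by
    apply Quiver.Hom.unop_inj
    apply PGPS.Hom.ext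
    funext p q
    show (sSup {a | a ≤ p.1} ≤ q.1) = (p.1 ≤ q.1)
    have : sSup {a | a ≤ p.1} = p.1 := le_antisymm (sSup_le fun _ h => h) (le_sSup le_rfl)
    rw [this]
  map_comp {L N K} f g := by
    apply Quiver.Hom.unop_inj
    apply PGPS.Hom.ext
    funext p q
    apply propext
    have hgf := (isGPMorphism_yRel L.frame K.frame (f ≫ g).map_sSup (f ≫ g).map_compact).iff_forall
      p q
    refine hgf.trans (forall₂_congr fun U hU => ?_)
    obtain ⟨k, hk, rfl⟩ := (isAdmissible_ySet_iff L.frame).1 hU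
    rw [box_yRel L.frame (f ≫ g).map_sSup]
    show _ ↔ (p ∈ box (yRel g.toFun) (box (yRel f.toFun) {y : ySet L | k ≤ y.1}) → _)
    rw [box_yRel L.frame f.map_sSup, box_yRel N.frame g.map_sSup]
    rfl

/-! ### Distributive envelopes and optimal filters: the functor `𝓧` -/

/-- Sup-homomorphisms: maps that preserve all finite meets and all *existing* finite joins (the
empty meet and the empty join included). Between lattices these are the lattice homomorphisms
which preserve the top, and the bottom whenever the domain has one. -/
structure IsSupHom {M N : Type u} [SemilatticeInf M] [OrderTop M] [SemilatticeInf N] [OrderTop N]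
    (f : M → N) : Prop where
  map_top : f ⊤ = ⊤
  map_inf : ∀ a b, f (a ⊓ b) = f a ⊓ f b
  map_isLUB : ∀ (S : Set M) (c : M), S.Finite → IsLUB S c → IsLUB (f '' S) (f c)

/-- `e : M → D` exhibits the distributive lattice `D` as the distributive envelope of `M`: it is
the universal sup-homomorphism from `M` to a distributive lattice with top, that is, the unit at
`M` of the left adjoint of the forgetful functor from distributive lattices. If `M` has a bottom,
then so has the target of every sup-homomorphism defined on `M`, and `D` is the envelope of `M`
among bounded distributive lattices. -/
structure IsDistribEnvelope {M D : Type u} [SemilatticeInf M] [OrderTop M] [DistribLattice D]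
    [OrderTop D] (e : M → D) : Prop where
  isSupHom : IsSupHom e
  existsUnique_lift : ∀ (E : Type u) [DistribLattice E] [OrderTop E] (f : M → E), IsSupHom f →
    ∃! g : D → E, IsSupHom g ∧ g ∘ e = f

section Optimal

variable {M N : Type u} [SemilatticeInf M] [OrderTop M] [SemilatticeInf N] [OrderTop N]

/-- Prime filters: proper filters `P` such that `F ∩ G ⊆ P` implies `F ⊆ P` or `G ⊆ P` for all
filters `F`, `G`. -/
def IsPrimeFilter (P : PFilter M) : Prop :=
  P ≠ ⊤ ∧ ∀ F G : PFilter M, (F : Set M) ∩ (G : Set M) ⊆ (P : Set M) →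
    (F : Set M) ⊆ (P : Set M) ∨ (G : Set M) ⊆ (P : Set M)

/-- Optimal filters: the restrictions to `M` of the prime filters of the distributive envelope
of `M`. -/
def IsOptimal (F : PFilter M) : Prop :=
  ∃ (D : Type u) (_ : DistribLattice D) (_ : OrderTop D) (e : M → D), IsDistribEnvelope e ∧
    ∃ P : PFilter D, IsPrimeFilter P ∧ ∀ a, a ∈ F ↔ e a ∈ P

theorem isPrimeFilter_iff {P : PFilter M} : IsPrimeFilter P ↔ InfPrime P := by
  have hinf : ∀ F G : PFilter M, (F : Set M) ∩ (G : Set M) ⊆ (P : Set M) ↔ F ⊓ G ≤ P :=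
    fun F G => ⟨fun h a ha => h (mem_inf_filter.1 ha), fun h a ha => h (mem_inf_filter.2 ha)⟩
  refine and_congr (not_congr isMax_iff_eq_top.symm) (forall₂_congr fun F G => ?_)
  rw [hinf]
  rfl

/-- Filters whose characteristic map to `{0, 1}` preserves existing finite joins. -/
def IsSupFilter (F : PFilter M) : Prop :=
  ∀ (S : Set M) (c : M), S.Finite → IsLUB S c → c ∈ F → ∃ a ∈ S, a ∈ F

theorem mem_finset_inf_filter {A : Finset (PFilter M)} {a : M} :
    a ∈ A.inf id ↔ ∀ F ∈ A, a ∈ F := by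
  rw [← PFilter.principal_le_iff, Finset.le_inf_iff]
  exact forall₂_congr fun F _ => PFilter.principal_le_iff

theorem mem_principal_filter {a b : M} : b ∈ PFilter.principal a ↔ a ≤ b := Iff.rfl

theorem IsPseudoprime.isSupFilter {F : PFilter M} (hF : IsPseudoprime F) : IsSupFilter F := by
  classical
  intro S c hS hc hcF
  obtain ⟨G, hG, hGF⟩ := hF.2 (hS.toFinset.image PFilter.principal)
    (wayBelow_of_le_compact (isCompactElement_principal c) (fun x hx => by
      rw [mem_finset_inf_filter] at hx
      refine hc.2 fun a ha => ?_
      exact hx (PFilter.principal a) (Finset.mem_image_of_mem _ (hS.mem_toFinset.2 ha)))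
      (PFilter.principal_le_iff.2 hcF))
  obtain ⟨a, ha, rfl⟩ := Finset.mem_image.1 hG
  exact ⟨a, hS.mem_toFinset.1 ha, PFilter.principal_le_iff.1 hGF⟩

theorem exists_primeFilter (hM : IsDistribMeet M) {F : PFilter M} {a : M} (ha : a ∉ F) :
    ∃ P : PFilter M, InfPrime P ∧ F ≤ P ∧ a ∉ P := by
  obtain ⟨P, hP, hFP, haP⟩ := exists_infPrime (isFrameLattice_filter hM)
    (fun h => ha (PFilter.principal_le_iff.1 h) : ¬ PFilter.principal a ≤ F)
  exact ⟨P, hP, hFP, fun h => haP (PFilter.principal_le_iff.2 h)⟩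

theorem isLUB_inf_image (hM : IsDistribMeet M) {S : Set M} (hS : S.Finite) {c : M}
    (h : ∀ u ∈ upperBounds S, c ≤ u) : IsLUB ((fun a => c ⊓ a) '' S) c := by
  classical
  refine ⟨by rintro _ ⟨a, -, rfl⟩; exact inf_le_left, fun u hu => ?_⟩
  by_contra hcu
  obtain ⟨P, hP, hcP, huP⟩ := exists_primeFilter hM (F := PFilter.principal c) (a := u) hcu
  obtain ⟨G, hG, hGP⟩ := infPrime_finset hP (A := hS.toFinset.image PFilter.principal)
    (fun x hx => by
      rw [mem_finset_inf_filter] at hx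
      exact hcP (h x fun a ha =>
        hx (PFilter.principal a) (Finset.mem_image_of_mem _ (hS.mem_toFinset.2 ha))))
  obtain ⟨a, ha, rfl⟩ := Finset.mem_image.1 hG
  refine huP (PFilter.mem_of_le (hu ⟨a, hS.mem_toFinset.1 ha, rfl⟩) (PFilter.inf_mem ?_ ?_))
  · exact hcP (mem_principal_filter.2 le_rfl)
  · exact PFilter.principal_le_iff.1 hGP

theorem IsSupFilter.isPseudoprime (hM : IsDistribMeet M) {F : PFilter M} (hF : IsSupFilter F)
    (htop : F ≠ ⊤) : IsPseudoprime F := by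
  classical
  refine ⟨htop, fun A hA => ?_⟩
  by_contra! hcon
  obtain ⟨K, hK, hAK, hKF⟩ := hA.exists_compact
  obtain ⟨c, rfl⟩ := isCompactElement_filter_iff.1 hK
  have hex : ∀ G : A, ∃ a ∈ G.1, a ∉ F := fun G => Set.not_subset.1 (hcon G.1 G.2)
  choose a haG haF using hex
  have hlub := isLUB_inf_image hM (Set.finite_range a) (c := c) fun u hu =>
    hAK (mem_finset_inf_filter.2 fun G hG =>
      PFilter.mem_of_le (hu ⟨⟨G, hG⟩, rfl⟩) (haG ⟨G, hG⟩))
  obtain ⟨_, ⟨_, ⟨G, rfl⟩, rfl⟩, hmem⟩ := hF _ c ((Set.finite_range a).image _) hlub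
    (PFilter.principal_le_iff.1 hKF)
  exact haF G (PFilter.mem_of_le inf_le_right hmem)

/-! #### A model of the distributive envelope -/

/-- The sets `φ(a) = {F | a ∈ F}` of sup-filters. -/
def phi (a : M) : Set {F : PFilter M // IsSupFilter F} := {F | a ∈ F.1}

theorem phi_inf (a b : M) : phi (a ⊓ b) = phi a ∩ phi b := by
  ext F
  exact PFilter.inf_mem_iff

theorem phi_top : phi (⊤ : M) = Set.univ :=
  Set.eq_univ_of_forall fun F => top_mem_filter F.1

/-- Finite unions of the sets `φ(a)`. -/
def phiUnion (s : Finset M) : Set {F : PFilter M // IsSupFilter F} := {F | ∃ a ∈ s, a ∈ F.1}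

/-- The nonempty finite unions of the sets `φ(a)` form a distributive lattice. -/
def envelope (M : Type u) [SemilatticeInf M] [OrderTop M] :
    Sublattice (Set {F : PFilter M // IsSupFilter F}) where
  carrier := {d | ∃ s : Finset M, s.Nonempty ∧ d = phiUnion s}
  supClosed' := by
    classical
    rintro _ ⟨s, hs, rfl⟩ _ ⟨t, ht, rfl⟩
    refine ⟨s ∪ t, hs.mono Finset.subset_union_left, ?_⟩
    ext F
    simp only [phiUnion, Set.sup_eq_union, Set.mem_union, Set.mem_ofPred_eq, Finset.mem_union]
    grind
  infClosed' := by
    classical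
    rintro _ ⟨s, hs, rfl⟩ _ ⟨t, ht, rfl⟩
    refine ⟨(s ×ˢ t).image fun p => p.1 ⊓ p.2, (hs.product ht).image _, ?_⟩
    ext F
    constructor
    · rintro ⟨⟨a, ha, haF⟩, ⟨b, hb, hbF⟩⟩
      exact ⟨a ⊓ b, Finset.mem_image.2 ⟨(a, b), Finset.mem_product.2 ⟨ha, hb⟩, rfl⟩,
        PFilter.inf_mem haF hbF⟩
    · rintro ⟨c, hc, hcF⟩
      obtain ⟨⟨a, b⟩, hab, rfl⟩ := Finset.mem_image.1 hc
      rw [Finset.mem_product] at hab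
      exact ⟨⟨a, hab.1, PFilter.mem_of_le inf_le_left hcF⟩,
        ⟨b, hab.2, PFilter.mem_of_le inf_le_right hcF⟩⟩

instance : OrderTop (envelope M) where
  top := ⟨Set.univ, {⊤}, Finset.singleton_nonempty _, by
    ext F; simpa [phiUnion] using top_mem_filter F.1⟩
  le_top d := Set.subset_univ d.1

/-- The embedding `a ↦ φ(a)`. -/
def envelopeMap (a : M) : envelope M :=
  ⟨phi a, {a}, Finset.singleton_nonempty _, by ext F; simp [phi, phiUnion]⟩

theorem isSupHom_envelopeMap : IsSupHom (envelopeMap (M := M)) where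
  map_top := Subtype.ext phi_top
  map_inf a b := Subtype.ext (phi_inf a b)
  map_isLUB S c hS hc := by
    refine ⟨?_, fun d hd F hF => ?_⟩
    · rintro _ ⟨a, ha, rfl⟩ F hF
      exact PFilter.mem_of_le (hc.1 ha) hF
    · obtain ⟨a, ha, haF⟩ := F.2 S c hS hc hF
      exact hd ⟨a, ha, rfl⟩ haF

theorem le_sup'_of_phi_subset (hM : IsDistribMeet M) {E : Type u} [DistribLattice E] [OrderTop E]
    {f : M → E} (hf : IsSupHom f) {c : M} {t : Finset M} (ht : t.Nonempty)
    (h : phi c ⊆ phiUnion t) : f c ≤ t.sup' ht f := by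
  have hub : ∀ u ∈ upperBounds (t : Set M), c ≤ u := by
    intro u hu
    by_contra hcu
    obtain ⟨P, hP, hcP, huP⟩ := exists_primeFilter hM (F := PFilter.principal c) (a := u) hcu
    obtain ⟨a, ha, haP⟩ := h (show (⟨P, (IsPseudoprime.of_infPrime hP).isSupFilter⟩ :
      {F : PFilter M // IsSupFilter F}) ∈ phi c from hcP (mem_principal_filter.2 le_rfl))
    exact huP (PFilter.mem_of_le (hu ha) haP)
  have hlub := hf.map_isLUB _ c (t.finite_toSet.image _)
    (isLUB_inf_image hM t.finite_toSet hub)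
  refine hlub.2 ?_
  rintro _ ⟨_, ⟨a, ha, rfl⟩, rfl⟩
  rw [hf.map_inf]
  exact inf_le_right.trans (Finset.le_sup' f ha)

theorem isDistribEnvelope_envelopeMap (hM : IsDistribMeet M) :
    IsDistribEnvelope (envelopeMap (M := M)) where
  isSupHom := isSupHom_envelopeMap
  existsUnique_lift E _ _ f hf := by
    classical
    choose s hs hd using fun d : envelope M => d.2
    have hle : ∀ (d : envelope M) (t : Finset M) (ht : t.Nonempty), d.1 ⊆ phiUnion t →
        (s d).sup' (hs d) f ≤ t.sup' ht f := fun d t ht h =>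
      Finset.sup'_le _ _ fun c hc => le_sup'_of_phi_subset hM hf ht fun F hF =>
        h (by rw [hd d]; exact ⟨c, hc, hF⟩)
    have hge : ∀ (d : envelope M) (c : M), phi c ⊆ d.1 → f c ≤ (s d).sup' (hs d) f :=
      fun d c h => le_sup'_of_phi_subset hM hf (hs d) (by rw [← hd d]; exact h)
    have hmono : ∀ d d' : envelope M, d ≤ d' →
        (s d).sup' (hs d) f ≤ (s d').sup' (hs d') f := fun d d' h =>
      hle d _ _ (by rw [← hd d']; exact h)
    refine ⟨fun d => (s d).sup' (hs d) f, ⟨⟨?_, ?_, ?_⟩, ?_⟩, ?_⟩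
    · refine top_le_iff.1 ?_
      rw [← hf.map_top]
      exact hge _ _ (Set.subset_univ _)
    · intro d d'
      refine le_antisymm (le_inf (hmono _ _ inf_le_left) (hmono _ _ inf_le_right)) ?_
      rw [Finset.sup'_inf_distrib_right]
      refine Finset.sup'_le _ _ fun a ha => ?_
      rw [Finset.sup'_inf_distrib_left]
      refine Finset.sup'_le _ _ fun b hb => ?_
      rw [← hf.map_inf]
      refine hge _ _ ?_
      rw [phi_inf]
      rintro F ⟨haF, hbF⟩
      refine ⟨?_, ?_⟩
      · rw [hd d]; exact ⟨a, ha, haF⟩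
      · rw [hd d']; exact ⟨b, hb, hbF⟩
    · intro S c hS hc
      refine ⟨?_, fun b hb => ?_⟩
      · rintro _ ⟨d, hdS, rfl⟩
        exact hmono _ _ (hc.1 hdS)
      · rcases S.eq_empty_or_nonempty with rfl | ⟨d₀, hd₀⟩
        · refine Finset.sup'_le _ _ fun a ha => ?_
          have hbot : ∀ x : M, a ≤ x := by
            intro x
            by_contra hax
            obtain ⟨P, hP, haP, hxP⟩ :=
              exists_primeFilter hM (F := PFilter.principal a) (a := x) hax
            have hcx : c ≤ envelopeMap x := hc.2 (by simp)
            refine hxP (hcx (show (⟨P, (IsPseudoprime.of_infPrime hP).isSupFilter⟩ :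
              {F : PFilter M // IsSupFilter F}) ∈ c.1 from ?_))
            rw [hd c]
            exact ⟨a, ha, haP (mem_principal_filter.2 le_rfl)⟩
          have := hf.map_isLUB ∅ a Set.finite_empty ⟨by simp, fun x _ => hbot x⟩
          exact this.2 (by simp)
        · let t : Finset M := hS.toFinset.biUnion s
          have ht : t.Nonempty := by
            obtain ⟨a, ha⟩ := hs d₀
            exact ⟨a, Finset.mem_biUnion.2 ⟨d₀, hS.mem_toFinset.2 hd₀, ha⟩⟩
          have hct : c ≤ ⟨phiUnion t, t, ht, rfl⟩ := hc.2 fun d hdS F hF => by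
            rw [hd d] at hF
            obtain ⟨a, ha, haF⟩ := hF
            exact ⟨a, Finset.mem_biUnion.2 ⟨d, hS.mem_toFinset.2 hdS, ha⟩, haF⟩
          refine (hle c t ht hct).trans (Finset.sup'_le _ _ fun a ha => ?_)
          obtain ⟨d, hdS, had⟩ := Finset.mem_biUnion.1 ha
          exact (Finset.le_sup' f had).trans (hb ⟨d, hS.mem_toFinset.1 hdS, rfl⟩)
    · funext a
      refine le_antisymm ?_ (hge _ _ subset_rfl)
      have := hle (envelopeMap a) {a} (Finset.singleton_nonempty a)
        (fun F hF => ⟨a, Finset.mem_singleton_self a, hF⟩)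
      simpa using this
    · rintro g ⟨hg, hge'⟩
      funext d
      have h1 : IsLUB (envelopeMap '' (s d : Set M)) d := by
        refine ⟨?_, fun d' hd' F hF => ?_⟩
        · rintro _ ⟨a, ha, rfl⟩ F hF
          show F ∈ d.1
          rw [hd d]
          exact ⟨a, ha, hF⟩
        · have hF' : F ∈ d.1 := hF
          rw [hd d] at hF'
          obtain ⟨a, ha, haF⟩ := hF'
          exact hd' ⟨a, ha, rfl⟩ haF
      have h2 := hg.map_isLUB _ d ((s d).finite_toSet.image _) h1
      rw [← Set.image_comp, hge'] at h2
      refine h2.unique ⟨?_, fun b hb => Finset.sup'_le _ _ fun a ha => hb ⟨a, ha, rfl⟩⟩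
      rintro _ ⟨a, ha, rfl⟩
      exact Finset.le_sup' f ha

theorem IsOptimal.isSupFilter {F : PFilter M} (hF : IsOptimal F) : IsSupFilter F := by
  obtain ⟨D, _, _, e, he, P, hP, hFP⟩ := hF
  intro S c hS hc hcF
  obtain ⟨_, ⟨a, ha, rfl⟩, haP⟩ :=
    (IsPseudoprime.of_infPrime (isPrimeFilter_iff.1 hP)).isSupFilter _ _ (hS.image e)
      (he.isSupHom.map_isLUB S c hS hc) ((hFP c).1 hcF)
  exact ⟨a, ha, (hFP a).2 haP⟩

theorem IsSupFilter.isOptimal (hM : IsDistribMeet M) {F : PFilter M} (hF : IsSupFilter F)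
    (htop : F ≠ ⊤) : IsOptimal F := by
  refine ⟨envelope M, inferInstance, inferInstance, envelopeMap,
    isDistribEnvelope_envelopeMap hM, mkFilter {d | ⟨F, hF⟩ ∈ d.1}
      (Set.mem_univ (⟨F, hF⟩ : {F : PFilter M // IsSupFilter F}))
      (fun _ h _ h' => ⟨h, h'⟩) (fun _ _ h h' => h h'), ⟨fun h => htop ?_, fun G H hGH => ?_⟩,
    fun a => Iff.rfl⟩
  · refine top_le_iff.1 fun a _ => ?_
    have : envelopeMap a ∈ (⊤ : PFilter (envelope M)) := mem_top_filter _
    rw [← h] at this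
    exact this
  · by_contra! hcon
    obtain ⟨d, hdG, hd⟩ := Set.not_subset.1 hcon.1
    obtain ⟨d', hdH, hd'⟩ := Set.not_subset.1 hcon.2
    rcases hGH (show d ⊔ d' ∈ _ from ⟨PFilter.mem_of_le le_sup_left hdG,
      PFilter.mem_of_le le_sup_right hdH⟩) with h | h
    · exact hd h
    · exact hd' h

/-- `X_M`: the optimal filters together with the improper filter. -/
def xSet (M : Type u) [SemilatticeInf M] [OrderTop M] : Set (PFilter M) := {F | IsOptimal F} ∪ {⊤}

theorem xSet_eq_ySet (hM : IsDistribMeet M) : xSet M = ySet (PFilter M) := by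
  ext F
  by_cases htop : F = ⊤
  · exact ⟨fun _ => Or.inr htop, fun _ => Or.inr htop⟩
  · constructor
    · rintro (h | h)
      · exact Or.inl (h.isSupFilter.isPseudoprime hM htop)
      · exact Or.inr h
    · rintro (h | h)
      · exact Or.inl (h.isSupFilter.isOptimal hM htop)
      · exact Or.inr h

/-- The topology on a set of filters with the subbasis of the sets `φ(a) = {F | a ∈ F}` and their
complements. -/
@[reducible]
def filterTopology (S : Set (PFilter M)) : TopologicalSpace S :=
  TopologicalSpace.generateFrom
    ({U | ∃ a : M, U = {F : S | a ∈ F.1}} ∪ {U | ∃ b : M, U = {F : S | b ∈ F.1}ᶜ})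

instance : TopologicalSpace (xSet M) := filterTopology (xSet M)

/-- The prime filters, as a subset of `X_M`. -/
def xPrimes (M : Type u) [SemilatticeInf M] [OrderTop M] : Set (xSet M) :=
  {F | IsPrimeFilter F.1}

/-- The improper filter `M`, as a point of `X_M`. -/
def xTop (M : Type u) [SemilatticeInf M] [OrderTop M] : xSet M := ⟨⊤, Or.inr rfl⟩

theorem filterTopology_ySet :
    filterTopology (ySet (PFilter M)) = (patchTopology (PFilter M)).induced Subtype.val := by
  rw [patchTopology, induced_generateFrom_eq, filterTopology]
  congr 1
  ext U
  constructor
  · rintro (⟨a, rfl⟩ | ⟨a, rfl⟩)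
    · refine ⟨_, Or.inl ⟨PFilter.principal a, isCompactElement_principal a, rfl⟩, ?_⟩
      ext F
      exact PFilter.principal_le_iff
    · refine ⟨_, Or.inr ⟨PFilter.principal a, isCompactElement_principal a, rfl⟩, ?_⟩
      ext F
      exact not_congr PFilter.principal_le_iff
  · rintro ⟨_, ⟨K, hK, rfl⟩ | ⟨K, hK, rfl⟩, rfl⟩
    · obtain ⟨a, rfl⟩ := isCompactElement_filter_iff.1 hK
      refine Or.inl ⟨a, ?_⟩
      ext F
      exact PFilter.principal_le_iff
    · obtain ⟨a, rfl⟩ := isCompactElement_filter_iff.1 hK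
      refine Or.inr ⟨a, ?_⟩
      ext F
      exact not_congr PFilter.principal_le_iff

theorem isPGPS_filter_aux (hM : IsDistribMeet M) {S : Set (PFilter M)}
    (hS : S = ySet (PFilter M)) (htop : ⊤ ∈ S) :
    @IsPGPS S (filterTopology S) _ {F | IsPrimeFilter F.1} ⟨⊤, htop⟩ ∧
      ∀ U, @IsAdmissible S (filterTopology S) _ {F | IsPrimeFilter F.1} U ↔
        ∃ a, U = {F | a ∈ F.1} := by
  subst hS
  rw [filterTopology_ySet]
  have hprime : {F : ySet (PFilter M) | IsPrimeFilter F.1} = yPrimes (PFilter M) :=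
    Set.ext fun F => isPrimeFilter_iff
  rw [hprime]
  refine ⟨isPGPS_ySet (isFrameLattice_filter hM), fun U =>
    (isAdmissible_ySet_iff (isFrameLattice_filter hM)).trans ⟨?_, ?_⟩⟩
  · rintro ⟨K, hK, rfl⟩
    obtain ⟨a, rfl⟩ := isCompactElement_filter_iff.1 hK
    refine ⟨a, ?_⟩
    ext F
    exact PFilter.principal_le_iff
  · rintro ⟨a, rfl⟩
    refine ⟨_, isCompactElement_principal a, ?_⟩
    ext F
    exact PFilter.principal_le_iff.symm

theorem isPGPS_xSet (hM : IsDistribMeet M) : IsPGPS (xPrimes M) (xTop M) :=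
  (isPGPS_filter_aux hM (xSet_eq_ySet hM) (Or.inr rfl)).1

theorem isAdmissible_xSet_iff (hM : IsDistribMeet M) {U : Set (xSet M)} :
    IsAdmissible (xPrimes M) U ↔ ∃ a, U = {F | a ∈ F.1} :=
  (isPGPS_filter_aux hM (xSet_eq_ySet hM) (Or.inr rfl)).2 U

/-- The relation `R_α ⊆ X_N × X_M` of `α : M → N`: `x R_α y` iff `α⁻¹(x) ⊆ y`. -/
def xRel (f : InfTopHom M N) (x : xSet N) (y : xSet M) : Prop := ∀ a, f a ∈ x.1 → a ∈ y.1

theorem box_xRel (hM : IsDistribMeet M) (f : InfTopHom M N) (a : M) :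
    box (xRel f) {y : xSet M | a ∈ y.1} = {x : xSet N | f a ∈ x.1} := by
  ext x
  refine ⟨fun h => ?_, fun h y hy => hy a h⟩
  by_contra hax
  obtain ⟨P, hP, hxP, haP⟩ := exists_primeFilter hM (F := filterComap f x.1) (a := a) hax
  exact haP (h ⟨P, xSet_eq_ySet hM ▸ Or.inl (.of_infPrime hP)⟩ fun b hb => hxP hb)

theorem isGPMorphism_xRel (hM : IsDistribMeet M) (hN : IsDistribMeet N) (f : InfTopHom M N) :
    IsGPMorphism (xPrimes N) (xPrimes M) (xRel f) where
  separated x y h := by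
    unfold xRel at h
    push Not at h
    obtain ⟨a, hax, hay⟩ := h
    exact ⟨_, (isAdmissible_xSet_iff hM).2 ⟨a, rfl⟩, fun z hz => hz a hax, hay⟩
  box_admissible U hU := by
    obtain ⟨a, rfl⟩ := (isAdmissible_xSet_iff hM).1 hU
    rw [box_xRel hM]
    exact (isAdmissible_xSet_iff hN).2 ⟨f a, rfl⟩

end Optimal

/-- The contravariant functor `𝓧`: it sends `M` to `⟨X_M, τ, ⊆, Pr(M), M⟩` and `α` to `R_α`. -/
def xFunctor : DMS.{u} ⥤ PGPS.{u}ᵒᵖ where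
  obj M := .op
    { carrier := xSet M
      dom := xPrimes M
      pt := xTop M
      isPGPS := isPGPS_xSet M.distrib }
  map {M N} f := Quiver.Hom.op
    ({ rel := xRel (M := M) (N := N) f
       isGPMorphism := isGPMorphism_xRel M.distrib N.distrib f } : PGPS.Hom _ _)
  map_id M := by
    apply Quiver.Hom.unop_inj
    apply PGPS.Hom.ext
    rfl
  map_comp {M N K} f g := by
    apply Quiver.Hom.unop_inj
    apply PGPS.Hom.ext
    funext x y
    apply propext
    have hgf := (isGPMorphism_xRel M.distrib K.distrib (f ≫ g)).iff_forall x y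
    refine hgf.trans (forall₂_congr fun U hU => ?_)
    obtain ⟨a, rfl⟩ := (isAdmissible_xSet_iff M.distrib).1 hU
    rw [box_xRel M.distrib (N := K) (f ≫ g)]
    show _ ↔ (x ∈ box (xRel (M := N) (N := K) g) (box (xRel (M := M) (N := N) f)
      {y : xSet M | a ∈ y.1}) → _)
    rw [box_xRel M.distrib (N := N) f, box_xRel N.distrib (N := K) g]
    rfl

/-- The map `U ↦ U` from `𝓐(X)` to `𝓚(𝓥ᵃ(X))`: an admissible clopen upset is regarded as a compact
element of the frame of admissible closed upsets. -/
def admToCompact (X : PGPS.{u}ᵒᵖ) :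
    admFunctor.obj X ⟶ (vietorisFunctor ⋙ compactFunctor).obj X :=
  ({ toFun := fun U => ⟨AdmClosed.ofAdmissible X.unop.isPGPS U.isAdmissible,
        (AdmClosed.isCompactElement_iff X.unop.isPGPS).2 U.isAdmissible⟩
     map_inf' := fun U V => CompactElt.ext (AdmClosed.ext (by
        show U.carrier ∩ V.carrier = (AdmClosed.ofAdmissible X.unop.isPGPS U.isAdmissible ⊔
          AdmClosed.ofAdmissible X.unop.isPGPS V.isAdmissible).carrier
        ext x
        rw [← sSup_pair, AdmClosed.mem_sSup]
        simp [AdmClosed.ofAdmissible]))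
     map_top' := CompactElt.ext (AdmClosed.ext (by
        show Set.univ = (⊥ : AdmClosed X.unop.dom).carrier
        ext x
        rw [← sSup_empty, AdmClosed.mem_sSup]
        simp)) } :
    InfTopHom (AdmClopen X.unop.dom) (CompactElt (AdmClosed X.unop.dom)))

end GenPriestley

open GenPriestley

/-! That the six assignments are functors is contained in their definitions, so what remains is to
find the natural isomorphisms and to compare composites.

For `DMS` and `AlgFrmJ` this is the classical correspondence between algebraic lattices and their
compact elements. The compact filters of `M` are the principal ones (`isCompactElement_filter_iff`),
so `a ↦ ↑a` identifies `M` with the dual of the compact elements of its filter lattice. Conversely,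
filters in the dual order are ideals of compact elements, and taking suprema identifies these with
the elements of `L` (`val_le_sSup_filter_iff`, `sSup_compactsBelow`). The order isomorphisms do not
need distributivity; it matters only for the objects, where distributivity of the semilattice
corresponds to the frame law.

For `AlgFrmJ` and `PGPS`, the unit sends `a` to `↑a ∩ Y_L`. It is an order embedding because primes
separate the elements of an algebraic frame, and it is onto because every admissible closed upset is
an intersection of admissible clopen ones, which in `Y_L` are the sets `↑k` with `k` compact
(`upClosed_le_iff`, `exists_eq_upClosed`). The counit need not be built on points: `𝓥ᵃ` is fully
faithful, so the unit alone supplies it. Faithfulness holds because `R` can be recovered from `□_R`.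
Fullness holds because a map that preserves joins is the box of the relation it induces
(`box_relOfMap`), where preservation of compact elements becomes preservation of admissible clopen
upsets.

The third equivalence is the composite of the first two. Its inverse `𝓚 ∘ 𝓥ᵃ` is replaced by `𝓐`,
since compact admissible closed upsets are the admissible clopen upsets. The equality `𝓧 = 𝓨 ∘ 𝓕`
holds on the nose: optimal filters are the pseudoprime elements of the filter lattice
(`xSet_eq_ySet`), principal filters being compact makes the topologies agree, and the right adjoint
of `F ↦ ↑α[F]` is the preimage under `α`. -/

namespace GenPriestley

/-! ### Isomorphisms from order isomorphisms -/

/-- An order isomorphism of distributive meet-semilattices is an isomorphism of `DMS`. -/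
def dmsIsoOfOrderIso {M N : DMS.{u}} (e : M ≃o N) : M ≅ N where
  hom := ({ toFun := e, map_inf' := e.map_inf, map_top' := e.map_top } : InfTopHom M N)
  inv := ({ toFun := e.symm, map_inf' := e.symm.map_inf, map_top' := e.symm.map_top } :
    InfTopHom N M)
  hom_inv_id := DFunLike.ext (F := InfTopHom M M) _ _ e.symm_apply_apply
  inv_hom_id := DFunLike.ext (F := InfTopHom N N) _ _ e.apply_symm_apply

/-- Compactness is expressed by the order alone, so a directed family in `N` can be pulled back
along `e.symm`. This supplies the second condition on morphisms of `AlgFrmJ`. -/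
theorem isCompactElement_orderIso {L N : Type u} [CompleteLattice L] [CompleteLattice N]
    (e : L ≃o N) {k : L} (hk : IsCompactElement k) : IsCompactElement (e k) := by
  rw [CompleteLattice.isCompactElement_iff_le_of_directed_sSup_le] at hk ⊢
  intro S hne hS h
  have hle : k ≤ sSup (e.symm '' S) := by
    rwa [sSup_image, ← e.symm.map_sSup, e.le_symm_apply]
  obtain ⟨_, ⟨x, hx, rfl⟩, hkx⟩ := hk (e.symm '' S) (hne.image _) (by
    rintro _ ⟨x, hx, rfl⟩ _ ⟨y, hy, rfl⟩
    obtain ⟨z, hz, hxz, hyz⟩ := hS x hx y hy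
    exact ⟨_, ⟨z, hz, rfl⟩, e.symm.monotone hxz, e.symm.monotone hyz⟩) hle
  exact ⟨x, hx, (e.le_symm_apply).1 hkx⟩

/-- An order isomorphism of algebraic frames, as a morphism of `AlgFrmJ`. -/
def AlgFrmJ.Hom.ofOrderIso {L N : AlgFrmJ.{u}} (e : L ≃o N) : AlgFrmJ.Hom L N where
  toFun := e
  map_sSup S := by rw [sSup_image, e.map_sSup]
  map_compact _ hk := isCompactElement_orderIso e hk

/-- An order isomorphism of algebraic frames is an isomorphism of `AlgFrmJ`. -/
def algFrmIsoOfOrderIso {L N : AlgFrmJ.{u}} (e : L ≃o N) : L ≅ N where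
  hom := AlgFrmJ.Hom.ofOrderIso e
  inv := AlgFrmJ.Hom.ofOrderIso e.symm
  hom_inv_id := AlgFrmJ.Hom.ext (funext e.symm_apply_apply)
  inv_hom_id := AlgFrmJ.Hom.ext (funext e.apply_symm_apply)

/-! ### The equivalence of `DMS` and `AlgFrmJ` -/

/-- A meet-semilattice is isomorphic to the dual of the compact elements of its lattice of
filters, via principal filters. -/
noncomputable def principalOrderIso (M : Type u) [SemilatticeInf M] [OrderTop M] :
    M ≃o CompactElt (PFilter M) where
  toEquiv := Equiv.ofBijective
    (fun a => ⟨PFilter.principal a, isCompactElement_principal a⟩) <| by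
      refine ⟨fun a b h => ?_, fun K => ?_⟩
      · have h' : PFilter.principal a = PFilter.principal b := congrArg CompactElt.val h
        exact le_antisymm (PFilter.principal_le_principal_iff.1 h'.ge)
          (PFilter.principal_le_principal_iff.1 h'.le)
      · obtain ⟨a, ha⟩ := isCompactElement_filter_iff.1 K.isCompact
        exact ⟨a, CompactElt.ext ha.symm⟩
  -- Passing to principal filters reverses the order, and the dual order on `CompactElt` reverses it
  -- back.
  map_rel_iff' := PFilter.principal_le_principal_iff

/-- The filter of the compact elements below `a`. -/
def compactsBelow {L : Type u} [CompleteLattice L] (a : L) : PFilter (CompactElt L) :=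
  mkFilter {k | k.val ≤ a} bot_le (fun _ hk _ hl => sup_le hk hl)
    (fun _ _ h hk => le_trans h hk)

/-- Meets in `CompactElt L` are joins in `L`, so a filter has a directed image in `L`. If the
compact `k` is below its supremum, then it is below a single member `l`; in the dual order this says
`l ≤ k`, whence `k ∈ F`. Hence a filter is recovered from its supremum. -/
theorem val_le_sSup_filter_iff {L : Type u} [CompleteLattice L] {F : PFilter (CompactElt L)}
    {k : CompactElt L} : k.val ≤ sSup (CompactElt.val '' (F : Set (CompactElt L))) ↔ k ∈ F := by
  refine ⟨fun h => ?_, fun h => le_sSup ⟨k, h, rfl⟩⟩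
  obtain ⟨_, ⟨l, hl, rfl⟩, hkl⟩ :=
    (CompleteLattice.isCompactElement_iff_le_of_directed_sSup_le _ _).1 k.isCompact
      (CompactElt.val '' (F : Set (CompactElt L))) (F.nonempty.image _) (by
        rintro _ ⟨a, ha, rfl⟩ _ ⟨b, hb, rfl⟩
        exact ⟨_, ⟨a ⊓ b, PFilter.inf_mem ha hb, rfl⟩, le_sup_left, le_sup_right⟩) h
  exact PFilter.mem_of_le (show l ≤ k from hkl) hl

/-- This is where algebraicity enters: `a` is the join of the compact elements below it. -/
theorem sSup_compactsBelow {L : Type u} [CompleteLattice L] [IsCompactlyGenerated L] (a : L) :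
    sSup (CompactElt.val '' (compactsBelow a : Set (CompactElt L))) = a := by
  refine le_antisymm (sSup_le ?_) ?_
  · rintro _ ⟨k, hk, rfl⟩
    exact hk
  · rw [le_iff_compact_le_imp]
    exact fun k hk hka => le_sSup ⟨⟨k, hk⟩, hka, rfl⟩

/-- An algebraic lattice is isomorphic to the lattice of filters of the dual of its compact
elements. -/
def filterCompactOrderIso (L : Type u) [CompleteLattice L] [IsCompactlyGenerated L] :
    PFilter (CompactElt L) ≃o L where
  toFun F := sSup (CompactElt.val '' (F : Set (CompactElt L)))
  invFun := compactsBelow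
  left_inv F := le_antisymm (fun _ hk => val_le_sSup_filter_iff.1 hk)
    fun _ hk => val_le_sSup_filter_iff.2 hk
  right_inv := sSup_compactsBelow
  map_rel_iff' {F G} := by
    refine ⟨fun h k hk => ?_, fun h => sSup_le_sSup (Set.image_mono h)⟩
    exact val_le_sSup_filter_iff.1 ((val_le_sSup_filter_iff.2 hk).trans h)

/-- The unit of the equivalence of `DMS` and `AlgFrmJ`. -/
noncomputable def filterUnit : 𝟭 DMS.{u} ≅ filterFunctor ⋙ compactFunctor :=
  NatIso.ofComponents
    (fun M => dmsIsoOfOrderIso (N := (filterFunctor ⋙ compactFunctor).obj M)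
      (principalOrderIso M))
    fun {M N} f => DFunLike.ext (F := InfTopHom M (CompactElt (PFilter N))) _ _ fun a =>
      -- Naturality is the identity `↑f[↑a] = ↑f(a)`.
      CompactElt.ext (filterMap_principal (M := M) (N := N) f a).symm

/-- The counit of the equivalence of `DMS` and `AlgFrmJ`. -/
def filterCounit : compactFunctor ⋙ filterFunctor ≅ 𝟭 AlgFrmJ.{u} :=
  NatIso.ofComponents
    (fun L => algFrmIsoOfOrderIso (L := (compactFunctor ⋙ filterFunctor).obj L)
      (filterCompactOrderIso L))
    fun {L N} f => by
      apply AlgFrmJ.Hom.ext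
      funext F
      change PFilter (CompactElt L) at F
      show sSup (CompactElt.val '' (filterMap (M := CompactElt L) (N := CompactElt N)
        (compactFunctor.map f) F : Set (CompactElt N))) =
        f.toFun (sSup (CompactElt.val '' (F : Set (CompactElt L))))
      rw [f.map_sSup]
      refine le_antisymm (sSup_le ?_) (sSup_le ?_)
      -- The upward closure is taken in the dual order, so it only adds elements that lie below some
      -- `f k` in `L`, and these do not change the supremum.
      · rintro _ ⟨l, ⟨k, hk, hkl⟩, rfl⟩
        exact le_trans hkl (le_sSup ⟨_, ⟨k, hk, rfl⟩, rfl⟩)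
      · rintro _ ⟨_, ⟨k, hk, rfl⟩, rfl⟩
        exact le_sSup ⟨⟨f.toFun k.val, f.map_compact _ k.isCompact⟩, ⟨k, hk, le_rfl⟩, rfl⟩

/-- `𝓕` and `𝓚` form an equivalence. -/
noncomputable def filterEquivalence : DMS.{u} ≌ AlgFrmJ.{u} :=
  .mk filterFunctor compactFunctor filterUnit filterCounit

/-! ### The dual equivalence of `AlgFrmJ` and `PGPS` -/

/-- The admissible closed upset `↑a ∩ Y_L`. -/
def upClosed {L : Type u} [CompleteLattice L] [IsCompactlyGenerated L] (hL : IsFrameLattice L)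
    (a : L) : AdmClosed (yPrimes L) where
  carrier := {y | a ≤ y.1}
  isClosed := by
    -- For a non-compact `a` the set is no longer clopen, but it is an intersection of clopen sets,
    -- because `a` is a join of compact elements.
    have : {y : ySet L | a ≤ y.1} =
        ⋂ k ∈ {k : L | IsCompactElement k ∧ k ≤ a}, {y : ySet L | k ≤ y.1} := by
      ext y
      simp only [Set.mem_iInter]
      exact ⟨fun h k hk => hk.2.trans h,
        fun h => le_iff_compact_le_imp.2 fun k hk hka => h k ⟨hk, hka⟩⟩
    rw [this]
    exact isClosed_biInter fun k hk => (isClopen_up hk.1).isClosed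
  isUpperSet := isUpperSet_up a
  compl_eq := compl_eq_lowerClosure (isUpperSet_up a) fun x hx => by
    -- A point outside the upset lies below a prime that is still outside it, which is the
    -- admissibility condition.
    obtain ⟨p, hp, hxp, hap⟩ := exists_infPrime hL hx
    exact ⟨⟨p, Or.inl (.of_infPrime hp)⟩, hp, hap, hxp⟩

/-- If `a` is not below `b`, some prime above `b` is not above `a`, and it is a point of `Y_L` that
distinguishes the two upsets. Reverse inclusion on `AdmClosed` makes the correspondence monotone. -/
theorem upClosed_le_iff {L : Type u} [CompleteLattice L] [IsCompactlyGenerated L]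
    (hL : IsFrameLattice L) {a b : L} : upClosed hL a ≤ upClosed hL b ↔ a ≤ b := by
  refine ⟨fun h => ?_, fun h y hy => h.trans hy⟩
  by_contra hab
  obtain ⟨p, hp, hbp, hap⟩ := exists_infPrime hL hab
  exact hap (h (show (⟨p, Or.inl (.of_infPrime hp)⟩ : ySet L) ∈ (upClosed hL b).carrier from hbp))

/-- An admissible closed upset is the intersection of the admissible clopen upsets that contain it.
Each of these is `↑k` for a compact `k`, and an intersection of sets `↑k` is the upset of the
supremum of these `k`. -/
theorem exists_eq_upClosed {L : Type u} [CompleteLattice L] [IsCompactlyGenerated L]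
    (hL : IsFrameLattice L) (C : AdmClosed (yPrimes L)) : ∃ a, upClosed hL a = C := by
  refine ⟨sSup {k | IsCompactElement k ∧ C.carrier ⊆ {y | k ≤ y.1}}, AdmClosed.ext ?_⟩
  ext y
  refine ⟨fun hy => ?_, fun hy => sSup_le fun k hk => hk.2 hy⟩
  by_contra hyC
  obtain ⟨U, hU, hCU, hyU⟩ := C.exists_admissible (isPGPS_ySet hL) hyC
  obtain ⟨k, hk, rfl⟩ := (isAdmissible_ySet_iff hL).1 hU
  exact hyU ((le_sSup (show k ∈ {k | IsCompactElement k ∧ C.carrier ⊆ {y | k ≤ y.1}} from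
    ⟨hk, hCU⟩)).trans hy)

/-- An algebraic frame is isomorphic to the frame of admissible closed upsets of its dual. -/
noncomputable def upClosedOrderIso {L : Type u} [CompleteLattice L] [IsCompactlyGenerated L]
    (hL : IsFrameLattice L) : L ≃o AdmClosed (yPrimes L) where
  toEquiv := Equiv.ofBijective (upClosed hL)
    ⟨fun _ _ h => le_antisymm ((upClosed_le_iff hL).1 h.le) ((upClosed_le_iff hL).1 h.ge),
      exists_eq_upClosed hL⟩
  map_rel_iff' := upClosed_le_iff hL

/-- The unit of the dual equivalence of `AlgFrmJ` and `PGPS`. -/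
noncomputable def yUnit : 𝟭 AlgFrmJ.{u} ≅ yFunctor ⋙ vietorisFunctor :=
  NatIso.ofComponents
    (fun L => algFrmIsoOfOrderIso (N := (yFunctor ⋙ vietorisFunctor).obj L)
      (upClosedOrderIso L.frame))
    fun {L _} f => AlgFrmJ.Hom.ext (funext fun a =>
      -- Naturality is the formula for `□` of `yRel`, which holds at every element of `L` and not
      -- only at the compact ones.
      AdmClosed.ext (box_yRel L.frame f.map_sSup a).symm)

/-- By the separation condition on morphisms, `R` is determined by the values of `□_R` on admissible
clopen upsets, and these are among the admissible closed upsets on which `𝓥ᵃ` records `□_R`. -/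
instance : vietorisFunctor.{u}.Faithful where
  map_injective {Y X R S} h := by
    apply Quiver.Hom.unop_inj
    apply PGPS.Hom.ext
    funext x y
    apply propext
    rw [R.unop.isGPMorphism.iff_forall, S.unop.isGPMorphism.iff_forall]
    refine forall₂_congr fun U hU => ?_
    have : box R.unop.rel U = box S.unop.rel U := congrArg AdmClosed.carrier
      (congrFun (congrArg AlgFrmJ.Hom.toFun h) (AdmClosed.ofAdmissible Y.unop.isPGPS hU))
    rw [this]

/-! ### Fullness of `𝓥ᵃ`: relations induced by join-preserving maps -/

section Full

variable {X Y : Type u} [TopologicalSpace X] [PartialOrder X] [TopologicalSpace Y] [PartialOrder Y]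
  {X₀ : Set X} {Y₀ : Set Y}

/-- The relation of a map of admissible closed upsets. -/
def relOfMap (f : AdmClosed Y₀ → AdmClosed X₀) (x : X) (y : Y) : Prop :=
  ∀ C : AdmClosed Y₀, x ∈ (f C).carrier → y ∈ C.carrier

/-- Joins are intersections, so the join of all `D` with `x ∈ f D` has the image `R[x]` of `x` as
its carrier. Since `f` preserves this join, `x` still lies in its image under `f`. Thus `R[x]` is
itself an admissible closed upset, the smallest one whose image contains `x`. -/
theorem box_relOfMap {f : AdmClosed Y₀ → AdmClosed X₀}
    (hf : ∀ S, f (sSup S) = sSup (f '' S)) (C : AdmClosed Y₀) :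
    box (relOfMap f) C.carrier = (f C).carrier := by
  ext x
  refine ⟨fun hx => ?_, fun hx y hy => hy C hx⟩
  set D : AdmClosed Y₀ := sSup {D | x ∈ (f D).carrier}
  -- In the reversed order this says that `R[x]` is contained in `C`; monotonicity of `f` then
  -- carries `x` from `f D` into `f C`.
  have hDC : C ≤ D := fun y hy => hx y fun E hE => AdmClosed.mem_sSup.1 hy E hE
  have hxD : x ∈ (f D).carrier := by
    rw [hf, AdmClosed.mem_sSup]
    rintro _ ⟨E, hE, rfl⟩
    exact hE
  exact (gc_rightAdj hf).monotone_l hDC hxD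

/-- The defining condition ranges over closed upsets, but a closed upset that misses `y` extends to
an admissible clopen one that still misses `y`. The box condition is preservation of compactness,
because the compact admissible closed upsets are the admissible clopen ones. -/
theorem isGPMorphism_relOfMap {m : X} {n : Y} (hX : IsPGPS X₀ m) (hY : IsPGPS Y₀ n)
    {f : AdmClosed Y₀ → AdmClosed X₀} (hf : ∀ S, f (sSup S) = sSup (f '' S))
    (hf' : ∀ C, IsCompactElement C → IsCompactElement (f C)) :
    IsGPMorphism X₀ Y₀ (relOfMap f) where
  separated x y h := by
    unfold relOfMap at h
    push Not at h
    obtain ⟨C, hxC, hyC⟩ := h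
    obtain ⟨U, hU, hCU, hyU⟩ := C.exists_admissible hY hyC
    exact ⟨U, hU, fun z hz => hCU (hz C hxC), hyU⟩
  box_admissible U hU := by
    have := box_relOfMap hf (AdmClosed.ofAdmissible hY hU)
    rw [show box (relOfMap f) U = _ from this, ← AdmClosed.isCompactElement_iff hX]
    exact hf' _ ((AdmClosed.isCompactElement_iff hY).2 hU)

end Full

instance : vietorisFunctor.{u}.Full where
  map_surjective {Y X} f := ⟨Quiver.Hom.op
    ({ rel := relOfMap (X₀ := X.unop.dom) (Y₀ := Y.unop.dom) f.toFun
       isGPMorphism := isGPMorphism_relOfMap X.unop.isPGPS Y.unop.isPGPS f.map_sSup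
        f.map_compact } : PGPS.Hom _ _),
    AlgFrmJ.Hom.ext (funext fun C => AdmClosed.ext
      (box_relOfMap (X₀ := X.unop.dom) (Y₀ := Y.unop.dom) f.map_sSup C))⟩

/-- The counit of the dual equivalence of `AlgFrmJ` and `PGPS`: as `𝓥ᵃ` is fully faithful, it is
determined by the unit. -/
noncomputable def yCounit : vietorisFunctor ⋙ yFunctor ≅ 𝟭 PGPS.{u}ᵒᵖ :=
  -- It suffices to compare the two functors after applying `𝓥ᵃ`. There `𝓥ᵃ ∘ 𝓨 ∘ 𝓥ᵃ` is isomorphic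
  -- to `𝓥ᵃ` by the inverse of the unit at the objects `𝓥ᵃ(X)`, so the points of `X` never have to
  -- be matched with pseudoprime elements.
  Functor.fullyFaithfulCancelRight vietorisFunctor
    (Functor.isoWhiskerLeft vietorisFunctor yUnit.symm)

/-- `𝓨` and `𝓥ᵃ` form a dual equivalence. -/
noncomputable def yEquivalence : AlgFrmJ.{u} ≌ PGPS.{u}ᵒᵖ :=
  .mk yFunctor vietorisFunctor yUnit yCounit

/-! ### The dual equivalence of `DMS` and `PGPS` -/

/-- Admissible clopen upsets are the compact admissible closed upsets. -/
def admClopenOrderIso {X : Type u} [TopologicalSpace X] [PartialOrder X] {X₀ : Set X} {m : X}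
    (h : IsPGPS X₀ m) : AdmClopen X₀ ≃o CompactElt (AdmClosed X₀) where
  toFun U := ⟨AdmClosed.ofAdmissible h U.isAdmissible,
    (AdmClosed.isCompactElement_iff h).2 U.isAdmissible⟩
  invFun K := ⟨K.val.carrier, (AdmClosed.isCompactElement_iff h).1 K.isCompact⟩
  left_inv _ := rfl
  right_inv _ := rfl
  -- The dual of reverse inclusion is inclusion.
  map_rel_iff' := Iff.rfl

/-- `𝓐` is isomorphic to `𝓚 ∘ 𝓥ᵃ`, via `U ↦ U`. -/
def admIso : admFunctor.{u} ≅ vietorisFunctor ⋙ compactFunctor :=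
  NatIso.ofComponents
    (fun X => dmsIsoOfOrderIso (N := (vietorisFunctor ⋙ compactFunctor).obj X)
      (admClopenOrderIso X.unop.isPGPS))
    -- On both sides a morphism acts by `□_R` on carriers.
    fun _ => rfl

theorem admIso_hom_app (X : PGPS.{u}ᵒᵖ) : admIso.hom.app X = admToCompact X := rfl

/-! ### The strict equality `𝓧 = 𝓨 ∘ 𝓕` -/

theorem PGPS.Hom.heq_of_rel {X X' Y Y' : PGPS.{u}} (hX : X = X') (hY : Y = Y')
    {R : PGPS.Hom X Y} {R' : PGPS.Hom X' Y'} (h : R.rel ≍ R'.rel) : R ≍ R' := by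
  subst hX hY
  exact heq_of_eq (PGPS.Hom.ext (eq_of_heq h))

theorem heq_op_of_heq {X X' Y Y' : PGPS.{u}} (hX : X = X') (hY : Y = Y')
    {R : X ⟶ Y} {R' : X' ⟶ Y'} (h : R ≍ R') : R.op ≍ R'.op := by
  subst hX hY
  rw [eq_of_heq h]

/-- The two spaces are subsets of one ambient poset and inherit its order, so once the subsets
coincide only the topology, the distinguished subset and the distinguished point remain to be
compared. Heterogeneous equality is needed because their types depend on the subset. -/
theorem PGPS.mk_eq_mk {A : Type u} [PartialOrder A] {S S' : Set A} (hS : S = S')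
    {t : TopologicalSpace S} {t' : TopologicalSpace S'} (ht : t ≍ t') {D : Set S} {D' : Set S'}
    (hD : D ≍ D') {m : S} {m' : S'} (hm : m ≍ m') (h : IsPGPS D m) (h' : IsPGPS D' m') :
    (⟨S, D, m, h⟩ : PGPS.{u}) = ⟨S', D', m', h'⟩ := by
  subst hS
  cases ht
  cases hD
  cases hm
  rfl

theorem heq_setOf_subtype {A : Type u} {S S' : Set A} (hS : S = S') {P P' : A → Prop}
    (hP : ∀ a, P a ↔ P' a) : ({x : S | P x.1} : Set S) ≍ ({x : S' | P' x.1} : Set S') := by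
  subst hS
  rw [funext fun a => propext (hP a)]

/-- The relations of both functors are restrictions of relations on arbitrary filters, so
equivalence on the ambient types suffices, without transport along the equality of the underlying
sets. -/
theorem heq_rel_subtype {A B : Type u} {S S' : Set A} {T T' : Set B} (hS : S = S') (hT : T = T')
    {r r' : A → B → Prop} (hr : ∀ a b, r a b ↔ r' a b) :
    (fun (x : S) (y : T) => r x.1 y.1) ≍ (fun (x : S') (y : T') => r' x.1 y.1) := by
  subst hS hT
  rw [funext₂ fun a b => propext (hr a b)]

theorem filterTopology_heq {M : Type u} [SemilatticeInf M] [OrderTop M] {S S' : Set (PFilter M)}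
    (hS : S = S') : filterTopology S ≍ filterTopology S' := by
  subst hS
  rfl

theorem heq_subtype_mk {A : Type u} {S S' : Set A} (hS : S = S') {a : A} (h : a ∈ S)
    (h' : a ∈ S') : (⟨a, h⟩ : S) ≍ (⟨a, h'⟩ : S') := by
  subst hS
  rfl

/-- Uniqueness of adjoints: taking preimages is already right adjoint to `filterMap f`. -/
theorem rightAdj_filterMap {M N : Type u} [SemilatticeInf M] [OrderTop M] [SemilatticeInf N]
    [OrderTop N] (f : InfTopHom M N) (G : PFilter N) :
    rightAdj (filterMap f) G = filterComap f G :=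
  le_antisymm (sSup_le fun F hF => (filter_gc f F G).1 hF)
    (le_sSup ((filter_gc f _ _).2 le_rfl))

theorem xFunctor_obj_unop_eq (M : DMS.{u}) :
    (xFunctor.obj M).unop = ((filterFunctor ⋙ yFunctor).obj M).unop :=
  -- The underlying sets agree because, among proper filters, the optimal and the pseudoprime ones
  -- are both those that respect existing finite joins.
  PGPS.mk_eq_mk (xSet_eq_ySet M.distrib)
    -- The subbases agree because the compact filters are the principal ones, and `↑a ⊆ F` means `a
    -- ∈ F`.
    ((filterTopology_heq (xSet_eq_ySet M.distrib)).trans (heq_of_eq filterTopology_ySet))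
    (heq_setOf_subtype (P := IsPrimeFilter) (P' := InfPrime) (xSet_eq_ySet M.distrib)
      fun _ => isPrimeFilter_iff)
    (heq_subtype_mk (xSet_eq_ySet M.distrib) (a := ⊤) (Or.inr rfl) (Or.inr rfl))
    (isPGPS_xSet M.distrib) (isPGPS_ySet (isFrameLattice_filter M.distrib))

theorem xFunctor_eq : xFunctor.{u} = filterFunctor ⋙ yFunctor :=
  Functor.hext (fun M => congrArg Opposite.op (xFunctor_obj_unop_eq M)) fun M N f =>
    -- Both functors are contravariant, so the underlying relation goes from the space of `N` to
    -- that of `M`.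
    heq_op_of_heq (xFunctor_obj_unop_eq N) (xFunctor_obj_unop_eq M)
      (PGPS.Hom.heq_of_rel (xFunctor_obj_unop_eq N) (xFunctor_obj_unop_eq M)
        (heq_rel_subtype (xSet_eq_ySet N.distrib) (xSet_eq_ySet M.distrib)
          (r := fun G F => ∀ a, (show InfTopHom M N from f) a ∈ G → a ∈ F)
          (r' := fun G F => rightAdj (filterMap (show InfTopHom M N from f)) G ≤ F)
          fun G F => by
            rw [rightAdj_filterMap]
            rfl))

/-- The composition of the other two equivalences, with the inverse replaced by `𝓐`. -/
noncomputable def filterYEquivalence : DMS.{u} ≌ PGPS.{u}ᵒᵖ :=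
  -- The functor of the composite is `𝓨 ∘ 𝓕`, which is equal to `𝓧`. Its inverse `𝓚 ∘ 𝓥ᵃ` is only
  -- isomorphic to `𝓐`, so it has to be exchanged.
  (filterEquivalence.trans yEquivalence).changeInverse admIso.symm

end GenPriestley

open GenPriestley
/-- The functors `𝓕`, `𝓚` form an equivalence of `DMS` and `AlgFrmJ`, the functors `𝓨`, `𝓥ᵃ` a dual
equivalence of `AlgFrmJ` and `PGPS`, and the functors `𝓧`, `𝓐` a dual equivalence of `DMS` and
`PGPS`; moreover `𝓧 = 𝓨 ∘ 𝓕`, and `𝓐 = 𝓚 ∘ 𝓥ᵃ` through the natural isomorphism that sends every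
admissible clopen upset to itself. -/
theorem mainTheorem2 :
    (∃ e : DMS.{u} ≌ AlgFrmJ.{u}, e.functor = filterFunctor ∧ e.inverse = compactFunctor) ∧
    (∃ e : AlgFrmJ.{u} ≌ PGPS.{u}ᵒᵖ, e.functor = yFunctor ∧ e.inverse = vietorisFunctor) ∧
    (∃ e : DMS.{u} ≌ PGPS.{u}ᵒᵖ, e.functor = xFunctor ∧ e.inverse = admFunctor) ∧
    xFunctor.{u} = filterFunctor ⋙ yFunctor ∧
    (∃ i : admFunctor.{u} ≅ vietorisFunctor ⋙ compactFunctor,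
      ∀ X : PGPS.{u}ᵒᵖ, i.hom.app X = admToCompact X) :=
  ⟨⟨filterEquivalence, rfl, rfl⟩, ⟨yEquivalence, rfl, rfl⟩,
    ⟨filterYEquivalence, xFunctor_eq.symm, rfl⟩, xFunctor_eq, admIso, admIso_hom_app⟩
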